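/- **Conventions.** $\mathbb N=\{0,1,2,\dots\}$, $\mathbb N^*=\{1,2,\dots\}$; $\mathfrak S_n$ is the set of permutations of $[n]=\{1,\dots,n\}$, $\mathfrak S=\bigcup_{n\ge1}\mathfrak S_n$, and $\mathfrak S_\infty$ is the set of bijections of $\mathbb N^*$. For $\sigma\in\mathfrak S_n$ write $|\sigma|=n$. For $\sigma$ in $\mathfrak S$ or $\mathfrak S_\infty$ the right-inversion counts are $r_i(\sigma)=\#\{j>i:\sigma(j)<\sigma(i)\}$. For $\rho_1,\rho_2,\dots\in\mathfrak S$, the infinite direct sum $\rho_1\oplus\rho_2\oplus\cdots\in\mathfrak S_\infty$ sends $|\rho_1|+\dots+|\rho_{k-1}|+i$ to $|\rho_1|+\dots+|\rho_{k-1}|+\rho_k(i)$ for all $k\ge1$ and $1\le i\le|\rho_k|$. A permutation in $\mathfrak S$ is a block if it is not the direct sum of two non-empty permutations. For $q\in[0,1)$, a random $\Sigma\in\mathfrak S_\infty$ is an infinite Mallows permutation with parameter $q$ if the $r_i(\Sigma)$, $i\ge1$, are independent with $\mathbb P(r_i(\Sigma)=n)=(1-q)q^n$ for all $n\in\mathbb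 N$. Such a $\Sigma$ a.s. has a first block, i.e. a unique block $B$ with $\Sigma=B\oplus\Sigma'$ for some $\Sigma'\in\mathfrak S_\infty$; the law of $B$ is called the Mallows block distribution with parameter $q$. A birth process on $[0,1)$ with rates $p(j,t)\ge0$ is an $\mathbb N$-valued (time-inhomogeneous) Markov process $(X_t)_{t\in[0,1)}$ with a.s. càdlàg non-decreasing paths such that, for all $t\in[0,1)$ and $j\in\mathbb N$, as $u\le v$ tend to $t$ with one of $u,v$ equal to $t$ and $u<v$, $$\mathbb P(X_v=j\mid X_u=j)=1-(v-u)p(j,t)+o(v-u),\qquad \mathbb P(X_v=j+1\mid X_u=j)=(v-u)p(j,t)+o(v-u),$$ whenever these conditional probabilities are defined. The geometric birth process $(R_t)_{t\in[0,1)}$ is the birth process with $R_0=1$ a.s. and rates $p(j,t)=\frac{j}{1-t}$. A continuous-time infinite Mallows process is a Markov process $(\Sigma_t)_{t\in[0,1)}$ with values in $\mathfrak S_\infty$ such that $\Sigma_t$ is an infinite Mallows permutation with parameter $t$ for every $t\in[0,1)$, and such that the processes $(r_i(\Sigma_t))_{t\in[0,1)}$, $i\ge1$, are independent birth processes. For $q\in[0,1)$,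 a $q$-block process is an $\mathfrak S$-valued process $(B_t)_{t\in[0,q]}$ whose right-inversion counts have a.s. càdlàg paths, such that: $B_q$ has the Mallows block distribution with parameter $q$; a.s. $|B_t|=|B_q|$ for all $t\in[0,q]$; and, conditionally given $B_q=\rho$ (for every $\rho\in\mathfrak S$ of positive probability), the processes $(r_i(B_t)+1)_{t\in[0,q]}$, $1\le i\le|\rho|$, are independent and the $i$-th one has the law of a geometric birth process on $[0,q]$ conditioned to take the value $r_i(\rho)+1$ at time $q$. **Theorem.** Let $(\Sigma_t)_{t\in[0,1)}$ be a continuous-time infinite Mallows process. Then, for every fixed $q\in[0,1)$, there are i.i.d. $q$-block processes $(B_{k,t})_{t\in[0,q]}$, $k\ge1$, defined on the same probability space, such that almost surely, simultaneously for all $t\in[0,q]$, $$\Sigma_t=B_{1,t}\oplus B_{2,t}\oplus\cdots\oplus B_{k,t}\oplus\cdots.$$ -/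

import Mathlib

open MeasureTheory ProbabilityTheory Filter Topology Asymptotics

universe u

namespace MallowsProcess

/-! ### Permutations

Positions and values are counted from `0` instead of `1`. -/

/-- The set of all finite permutations, of arbitrary positive size. -/
structure FinPerm where
  size : ℕ+
  perm : Equiv.Perm (Fin size)

/-- The discrete σ-algebra on the countable set of finite permutations. -/
instance : MeasurableSpace FinPerm := ⊤

/-- The σ-algebra on the permutations of `ℕ` generated by the evaluations `σ ↦ σ i`. -/
instance instMeasurableSpacePermNat : MeasurableSpace (Equiv.Perm ℕ) :=
  MeasurableSpace.comap (fun (σ : Equiv.Perm ℕ) (i : ℕ) => σ i) MeasurableSpace.pi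

/-- Right-inversion counts of an infinite permutation:
`r_i(σ) = #{j > i : σ j < σ i}`. This set is always finite. -/
noncomputable def rightInv (i : ℕ) (σ : Equiv.Perm ℕ) : ℕ :=
  Set.ncard {j : ℕ | i < j ∧ σ j < σ i}

/-- Right-inversion counts of a finite permutation:
`r_i(ρ) = #{j > i : ρ j < ρ i}`, with value `0` for `i` beyond the size of `ρ`. -/
noncomputable def FinPerm.rightInv (i : ℕ) (ρ : FinPerm) : ℕ :=
  Set.ncard {j : Fin ρ.size | ∃ hi : i < ρ.size, i < j ∧ ρ.perm j < ρ.perm ⟨i, hi⟩}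

/-- `ρ` is a block: it is not the direct sum of two non-empty permutations, that is, no
proper non-empty initial segment is mapped into itself. -/
def FinPerm.IsBlock (ρ : FinPerm) : Prop :=
  ∀ m : ℕ, 0 < m → m < ρ.size → ¬ ∀ i : Fin ρ.size, (i : ℕ) < m → (ρ.perm i : ℕ) < m

/-- The position where the `k`-th summand of an infinite direct sum starts. -/
def offset (ρ : ℕ → FinPerm) (k : ℕ) : ℕ := ∑ j ∈ Finset.range k, ((ρ j).size : ℕ)

/-- `σ = ρ 0 ⊕ ρ 1 ⊕ ρ 2 ⊕ ⋯`. As all sizes are positive, every natural number is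
`offset ρ k + i` for exactly one `k` and one `i : Fin (ρ k).size`. -/
def IsDirectSum (σ : Equiv.Perm ℕ) (ρ : ℕ → FinPerm) : Prop :=
  ∀ (k : ℕ) (i : Fin (ρ k).size), σ (offset ρ k + i) = offset ρ k + (ρ k).perm i

/-- `ρ` is the first block of `σ`: `ρ` is a block and `σ = ρ ⊕ σ'` for some infinite
permutation `σ'`. -/
def IsFirstBlock (ρ : FinPerm) (σ : Equiv.Perm ℕ) : Prop :=
  ρ.IsBlock ∧ ∀ i : Fin ρ.size, σ i = ρ.perm i

/-! ### Stochastic processes -/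

/-- The time set `[0,1)`. -/
abbrev UnitTime : Type := Set.Ico (0 : ℝ) 1

/-- The time `0`. -/
def zeroTime : UnitTime := ⟨0, le_refl 0, zero_lt_one⟩

/-- A path is càdlàg: right-continuous with left limits. -/
def IsCadlag {ι E : Type*} [TopologicalSpace ι] [Preorder ι] [TopologicalSpace E]
    (f : ι → E) : Prop :=
  ∀ t, ContinuousWithinAt f (Set.Ici t) t ∧ ∃ l, Tendsto f (𝓝[<] t) (𝓝 l)

/-- `X` is a (not necessarily time-homogeneous) Markov process: for `s ≤ t`, the conditional
probability of `{X t ∈ A}` given `(X u, u ≤ s)` equals the one given `X s`. -/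
structure IsMarkovProcess {ι Ω E : Type*} [Preorder ι] [MeasurableSpace Ω] [mE : MeasurableSpace E]
    (μ : Measure Ω) (X : ι → Ω → E) : Prop where
  measurable : ∀ t, Measurable (X t)
  markov : ∀ s t, s ≤ t → ∀ A : Set E, MeasurableSet A →
    μ[(X t ⁻¹' A).indicator (fun _ => (1 : ℝ)) | ⨆ u : Set.Iic s, MeasurableSpace.comap (X u) mE]
      =ᵐ[μ] μ[(X t ⁻¹' A).indicator (fun _ => (1 : ℝ)) | MeasurableSpace.comap (X s) mE]

/-- The conditional probability `P(X t = k | X s = j)`, meaningful if `P(X s = j) ≠ 0`. -/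
noncomputable def transProb {ι Ω : Type*} [MeasurableSpace Ω] (μ : Measure Ω) (X : ι → Ω → ℕ)
    (s t : ι) (j k : ℕ) : ℝ :=
  (ProbabilityTheory.cond μ {ω | X s ω = j}).real {ω | X t ω = k}

/-- The times near `t` for which the transition between `s` and `t`, started from the state `j`
at the earlier of the two times, has a well-defined probability. -/
def admissible {Ω : Type*} [MeasurableSpace Ω] (μ : Measure Ω) (X : UnitTime → Ω → ℕ)
    (t : UnitTime) (j : ℕ) : Set UnitTime :=
  {s | s ≠ t ∧ μ {ω | X (min s t) ω = j} ≠ 0}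

/-- `X` is a birth process on `[0,1)` with values in `ℕ` and infinitesimal birth rates `p j t`:
it is Markov, with (almost surely) càdlàg and non-decreasing paths, and as `s → t`
(from either side), the probability to stay in `j` between the times `s` and `t` is
`1 - |s - t| p j t + o(|s - t|)` and the probability to go from `j` to `j + 1` is
`|s - t| p j t + o(|s - t|)`. -/
structure IsBirthProcess {Ω : Type*} [MeasurableSpace Ω] (μ : Measure Ω)
    (X : UnitTime → Ω → ℕ) (p : ℕ → UnitTime → ℝ) : Prop where
  markov : IsMarkovProcess μ X
  cadlag : ∀ᵐ ω ∂μ, IsCadlag (fun t => X t ω)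
  monotone : ∀ᵐ ω ∂μ, Monotone (fun t => X t ω)
  rate_nonneg : ∀ j t, 0 ≤ p j t
  rate_stay : ∀ j t,
    (fun s : UnitTime =>
        transProb μ X (min s t) (max s t) j j - (1 - |(s : ℝ) - t| * p j t))
      =o[𝓝[admissible μ X t j] t] (fun s : UnitTime => |(s : ℝ) - t|)
  rate_jump : ∀ j t,
    (fun s : UnitTime =>
        transProb μ X (min s t) (max s t) j (j + 1) - |(s : ℝ) - t| * p j t)
      =o[𝓝[admissible μ X t j] t] (fun s : UnitTime => |(s : ℝ) - t|)

/-- The geometric birth process: the birth process started at `1`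
with birth rates `p(j,t) = j / (1 - t)`. -/
structure IsGeometricBirthProcess {Ω : Type*} [MeasurableSpace Ω] (μ : Measure Ω)
    (R : UnitTime → Ω → ℕ) : Prop where
  start : ∀ᵐ ω ∂μ, R zeroTime ω = 1
  birth : IsBirthProcess μ R (fun j t => j / (1 - (t : ℝ)))

/-! ### Infinite Mallows permutations and the continuous-time process -/

/-- The parameter `1 - q`, as an element of the unit interval. -/
def oneSub (q : UnitTime) : unitInterval :=
  unitInterval.symm ⟨q, q.2.1, q.2.2.le⟩

/-- `ν` is the infinite Mallows distribution with parameter `q`: the right-inversion counts are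
independent, and each takes the value `n` with probability `(1 - q) q ^ n`. -/
structure IsInfiniteMallows (q : UnitTime) (ν : Measure (Equiv.Perm ℕ)) : Prop where
  indep : iIndepFun (fun (i : ℕ) (σ : Equiv.Perm ℕ) => rightInv i σ) ν
  geometric : ∀ i, HasLaw (fun σ : Equiv.Perm ℕ => rightInv i σ) (geometricMeasure (oneSub q)) ν

/-- `S` is a continuous-time infinite Mallows process: a Markov process of infinite permutations
with infinite Mallows marginals, whose right-inversion counts are independent birth processes. -/
structure IsContinuousMallows {Ω : Type*} [MeasurableSpace Ω] (μ : Measure Ω)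
    (S : UnitTime → Ω → Equiv.Perm ℕ) : Prop where
  markov : IsMarkovProcess μ S
  marginal : ∀ t, IsInfiniteMallows t (μ.map (S t))
  indep : iIndepFun (fun (i : ℕ) (ω : Ω) (t : UnitTime) => rightInv i (S t ω)) μ
  birth : ∀ i, ∃ p, IsBirthProcess μ (fun t ω => rightInv i (S t ω)) p

/-! ### Block processes -/

/-- `β` is the Mallows block distribution with parameter `q`: the law of the first block of an
infinite Mallows permutation. -/
def IsMallowsBlock (q : UnitTime) (β : Measure FinPerm) : Prop :=
  ∃ ν : Measure (Equiv.Perm ℕ), IsInfiniteMallows q ν ∧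
    ∀ ρ : FinPerm, β {ρ} = ν {σ | IsFirstBlock ρ σ}

/-- `γ` is the law on path space of the geometric birth process. -/
def IsGeometricBirthLaw (γ : Measure (UnitTime → ℕ)) : Prop :=
  ∃ (Ω : Type u) (_ : MeasurableSpace Ω) (P : Measure Ω) (R : UnitTime → Ω → ℕ),
    IsProbabilityMeasure P ∧ IsGeometricBirthProcess P R ∧ γ = P.map (fun ω t => R t ω)

/-- The end time `q` of the interval `[0,q]`. -/
def endTime (q : UnitTime) : Set.Iic q := ⟨q, le_refl q⟩

/-- `B` is a `q`-block process on the time interval `[0,q]`: its value at time `q` has the Mallows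
block distribution, its size is constant in time, and given `B_q = ρ`, the processes
`r_i(B_t) + 1`, `i < |ρ|`, are independent geometric birth processes, each
conditioned to be equal to `r_i(ρ) + 1` at time `q`. -/
structure IsBlockProcess {Ω : Type u} [MeasurableSpace Ω] (μ : Measure Ω) (q : UnitTime)
    (B : Set.Iic q → Ω → FinPerm) : Prop where
  measurable : ∀ t, Measurable (B t)
  cadlag : ∀ᵐ ω ∂μ, ∀ i, IsCadlag (fun t => (B t ω).rightInv i)
  size_eq : ∀ᵐ ω ∂μ, ∀ t, (B t ω).size = (B (endTime q) ω).size
  block : IsMallowsBlock q (μ.map (B (endTime q)))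
  cond_indep : ∀ ρ : FinPerm, μ {ω | B (endTime q) ω = ρ} ≠ 0 →
    iIndepFun (fun (i : Fin ρ.size) (ω : Ω) (t : Set.Iic q) => (B t ω).rightInv i + 1)
      (ProbabilityTheory.cond μ {ω | B (endTime q) ω = ρ})
  cond_law : ∃ γ : Measure (UnitTime → ℕ), IsGeometricBirthLaw.{u} γ ∧
    ∀ ρ : FinPerm, μ {ω | B (endTime q) ω = ρ} ≠ 0 → ∀ i : Fin ρ.size,
      (ProbabilityTheory.cond μ {ω | B (endTime q) ω = ρ}).map
          (fun (ω : Ω) (t : Set.Iic q) => (B t ω).rightInv i + 1) =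
        (ProbabilityTheory.cond γ {R | R q = ρ.rightInv i + 1}).map
          (fun (R : UnitTime → ℕ) (t : Set.Iic q) => R t)

end MallowsProcess

namespace MallowsProcess

/-! ### Right-inversion counts and cuts -/

/-! A permutation `σ` preserves `[0,m)` exactly when `i + rightInv i σ < m` for all `i < m`
(`forall_apply_lt_iff`): such an `m` is a cut. Birth paths are nondecreasing, so a cut at time `q`
is a cut at every `t ≤ q`. Hence the division into blocks at time `q` splits all earlier
permutations as well, and each window inherits the right-inversion counts of the large permutation
(`exists_window`, `block_spec`).

The probabilistic input is that the count paths are i.i.d. Independence is given. For equality in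
law, write `F_n(t) = P(A, X_t ≤ n)` with `A` in the past. Its right derivative is `-p(n,t) P(A, X_t
= n)`. With `A` the whole space, the geometric marginals force `p(n,t) = (n+1)/(1-t)` at every state
of positive probability. The equations are triangular in `n`, so they have a unique solution, which
fixes the finite-dimensional laws (`IsBirthProcess.map_path_eq`).

The end of the first block is then a stopping time of an i.i.d. sequence of paths, where only the
values at `q` decide about cuts. It is a.s. finite: `m` is a cut with probability `∏ (1 - q^j)`, `1
≤ j ≤ m`, which is bounded below, and Kolmogorov's 0-1 law applies (`ae_blockLen_pos`). Regeneration
at the cuts gives i.i.d. blocks (`iIndepFun_blocks`). Finally, a block equals `ρ` at time `q` iff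
a.s. its first `|ρ|` paths take the values `r_i(ρ)` at `q`. This is a product event, so the
conditional law is a product of conditioned path laws (`map_cond_block`). -/

lemma lt_of_apply_lt {σ : Equiv.Perm ℕ} {m : ℕ} (h : ∀ i < m, σ i < m) {j : ℕ} (hj : σ j < m) :
    j < m := by
  have h1 : (Finset.range m).image σ = Finset.range m := by
    apply Finset.eq_of_subset_of_card_le
    · intro x hx
      obtain ⟨i, hi, rfl⟩ := Finset.mem_image.1 hx
      exact Finset.mem_range.2 (h i (Finset.mem_range.1 hi))
    · rw [Finset.card_image_of_injective _ σ.injective]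
  have h2 : σ j ∈ (Finset.range m).image σ := by rw [h1]; exact Finset.mem_range.2 hj
  obtain ⟨i, hi, hij⟩ := Finset.mem_image.1 h2
  rw [← σ.injective hij]
  exact Finset.mem_range.1 hi

lemma finite_setOf_apply_lt (σ : Equiv.Perm ℕ) (n : ℕ) : {j | σ j < n}.Finite :=
  (Set.finite_Iio n).preimage σ.injective.injOn

lemma ncard_setOf_apply_lt (σ : Equiv.Perm ℕ) (n : ℕ) : {j | σ j < n}.ncard = n := by
  have h : σ '' {j | σ j < n} = Set.Iio n := by
    ext v
    exact ⟨fun ⟨j, hj, hv⟩ => hv ▸ hj, fun hv => ⟨σ.symm v, by simpa using hv, by simp⟩⟩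
  rw [← Set.ncard_image_of_injective _ σ.injective, h, Set.ncard_eq_toFinset_card', Set.toFinset_Iio,
    Nat.card_Iio]

/-- Exactly `σ i` positions carry a value below `σ i`; each lies before `i` or is counted by
`rightInv i σ`. -/
lemma apply_le_add_rightInv (σ : Equiv.Perm ℕ) (i : ℕ) : σ i ≤ i + rightInv i σ := by
  have h : {j | σ j < σ i} ⊆ Set.Iio i ∪ {j | i < j ∧ σ j < σ i} := by
    intro j hj
    rcases lt_trichotomy j i with h | h | h
    · exact Or.inl h
    · subst h; exact absurd (show σ j < σ j from hj) (lt_irrefl _)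
    · exact Or.inr ⟨h, hj⟩
  have hf : {j | i < j ∧ σ j < σ i}.Finite :=
    (finite_setOf_apply_lt σ (σ i)).subset fun j hj => hj.2
  calc σ i = {j | σ j < σ i}.ncard := (ncard_setOf_apply_lt σ _).symm
    _ ≤ (Set.Iio i ∪ {j | i < j ∧ σ j < σ i}).ncard :=
      Set.ncard_le_ncard h ((Set.finite_Iio i).union hf)
    _ ≤ (Set.Iio i).ncard + {j | i < j ∧ σ j < σ i}.ncard := Set.ncard_union_le _ _
    _ = i + rightInv i σ := by
      rw [Set.ncard_eq_toFinset_card', Set.toFinset_Iio, Nat.card_Iio, rightInv]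

lemma forall_apply_lt_iff (σ : Equiv.Perm ℕ) (m : ℕ) :
    (∀ i < m, σ i < m) ↔ ∀ i < m, i + rightInv i σ < m := by
  refine ⟨fun h i hi => ?_, fun h i hi => (apply_le_add_rightInv σ i).trans_lt (h i hi)⟩
  -- If `[0,m)` is preserved, smaller values than `σ i` sit at positions below `m`, which leaves
  -- only `m - i - 1` positions to the right of `i`.
  have h1 : {j | i < j ∧ σ j < σ i} ⊆ (Finset.Ioo i m : Set ℕ) := by
    intro j hj
    rw [Finset.coe_Ioo]
    exact ⟨hj.1, lt_of_apply_lt h (hj.2.trans (h i hi))⟩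
  have h2 := Set.ncard_le_ncard h1 (Finset.finite_toSet _)
  rw [Set.ncard_coe_finset, Nat.card_Ioo] at h2
  unfold rightInv
  omega

/-- A code `a` cuts at `m` if the permutation with right-inversion counts `a` maps `[0,m)` to
itself. -/
def IsCut (a : ℕ → ℕ) (m : ℕ) : Prop := 0 < m ∧ ∀ i < m, i + a i < m

/-- The first cut of a code, or `0` if there is none. -/
noncomputable def firstCut (a : ℕ → ℕ) : ℕ := sInf {m | IsCut a m}

lemma isCut_congr {a b : ℕ → ℕ} {m n : ℕ} (hm : m ≤ n) (h : ∀ i < n, a i = b i) :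
    IsCut a m ↔ IsCut b m :=
  and_congr_right fun _ => forall₂_congr fun i hi => by rw [h i (hi.trans_le hm)]

lemma firstCut_eq_iff {a : ℕ → ℕ} {n : ℕ} (hn : 0 < n) :
    firstCut a = n ↔ IsCut a n ∧ ∀ m < n, ¬ IsCut a m := by
  constructor
  · rintro rfl
    have h : {m | IsCut a m}.Nonempty := Nat.nonempty_of_pos_sInf hn
    exact ⟨Nat.sInf_mem h, fun m hm => Nat.notMem_of_lt_sInf hm⟩
  · rintro ⟨h1, h2⟩
    refine le_antisymm (Nat.sInf_le h1) ?_
    by_contra! hlt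
    exact h2 _ hlt (Nat.sInf_mem (s := {m | IsCut a m}) ⟨n, h1⟩)

lemma firstCut_congr {a b : ℕ → ℕ} {n : ℕ} (hn : 0 < n) (h : ∀ i < n, a i = b i) :
    firstCut a = n ↔ firstCut b = n := by
  rw [firstCut_eq_iff hn, firstCut_eq_iff hn, isCut_congr le_rfl h]
  exact and_congr_right fun _ => forall₂_congr fun m hm => by rw [isCut_congr hm.le h]

/-! ### Finite permutations recovered from their right-inversion counts -/

lemma FinPerm.ext_iff_rightInv {ρ ρ' : FinPerm} (hs : ρ.size = ρ'.size)
    (h : ∀ i < (ρ.size : ℕ), ρ.rightInv i = ρ'.rightInv i) : ρ = ρ' := by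
  obtain ⟨n, ρ⟩ := ρ
  obtain ⟨m, ρ'⟩ := ρ'
  obtain rfl : n = m := hs
  -- Once the values before `i` are known, the count at `i` is the number of unused values below the
  -- `i`-th value, hence strictly increasing in that value. So the values are determined one after
  -- the other.
  have key : ∀ (ρ ρ' : Equiv.Perm (Fin n)) (i : Fin n), (∀ j < i, ρ j = ρ' j) → ρ i < ρ' i →
      FinPerm.rightInv i ⟨n, ρ⟩ < FinPerm.rightInv i ⟨n, ρ'⟩ := by
    intro ρ ρ' i hj hi
    have e : ∀ τ : Equiv.Perm (Fin n), FinPerm.rightInv i ⟨n, τ⟩ =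
        {v : Fin n | v < τ i ∧ ∀ j < i, τ j ≠ v}.ncard := by
      intro τ
      rw [FinPerm.rightInv, ← Set.ncard_image_of_injective _ τ.injective]
      congr 1
      ext v
      constructor
      · rintro ⟨j, ⟨_, hij, hv⟩, rfl⟩
        exact ⟨hv, fun k hk hkj => absurd (τ.injective hkj ▸ hk) (not_lt.2 hij.le)⟩
      · rintro ⟨hv, hv'⟩
        refine ⟨τ.symm v, ⟨i.2, ?_, by simpa using hv⟩, by simp⟩
        rcases lt_trichotomy (τ.symm v) i with h | h | h
        · exact absurd (τ.apply_symm_apply v) (hv' _ h)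
        · rw [← h] at hv; simp at hv
        · exact h
    rw [e, e]
    apply Set.ncard_lt_ncard _ (Set.toFinite _)
    refine ⟨fun v hv => ⟨hv.1.trans hi, fun j hji => hj j hji ▸ hv.2 j hji⟩, fun hsub => ?_⟩
    have : ρ i ∈ {v : Fin n | v < ρ i ∧ ∀ j < i, ρ j ≠ v} :=
      hsub ⟨hi, fun j hji he => by
        rw [← hj j hji] at he
        exact hji.ne (ρ.injective he)⟩
    exact lt_irrefl _ this.1
  congr 1
  ext i
  induction i using WellFoundedLT.induction with
  | ind i ih =>
    have ih' : ∀ j < i, ρ j = ρ' j := fun j hj => Fin.ext (ih j hj)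
    have hi := h i i.2
    rcases lt_trichotomy (ρ i) (ρ' i) with h | h | h
    · exact absurd hi (key ρ ρ' i ih' h).ne
    · rw [h]
    · exact absurd hi (key ρ' ρ i (fun j hj => (ih' j hj).symm) h).ne'

/-- The finite permutation of size `n` with the right-inversion counts `c`, if it exists. -/
noncomputable def decode (n : ℕ) (c : Fin n → ℕ) : FinPerm :=
  open Classical in
  if h : ∃ ρ : FinPerm, (ρ.size : ℕ) = n ∧ ∀ i : Fin n, ρ.rightInv i = c i then h.choose
  -- Arbitrary value, met only for vectors that are not the counts of a permutation of size `n`.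
  else ⟨1, 1⟩

lemma decode_eq {n : ℕ} {c : Fin n → ℕ} {ρ : FinPerm} (hn : (ρ.size : ℕ) = n)
    (h : ∀ i : Fin n, ρ.rightInv i = c i) : decode n c = ρ := by
  have hex : ∃ ρ : FinPerm, (ρ.size : ℕ) = n ∧ ∀ i : Fin n, ρ.rightInv i = c i := ⟨ρ, hn, h⟩
  rw [decode, dif_pos hex]
  have hc := hex.choose_spec
  refine FinPerm.ext_iff_rightInv (PNat.coe_injective (hc.1.trans hn.symm)) fun i hi => ?_
  have hi' : i < n := by rw [← hc.1]; exact hi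
  exact (hc.2 ⟨i, hi'⟩).trans (h ⟨i, hi'⟩).symm

/-- The restriction of a permutation to an interval `[T, T + n)` between two cuts. -/
lemma exists_window {σ : Equiv.Perm ℕ} {T n : ℕ} (hn : 0 < n) (h1 : ∀ i < T, σ i < T)
    (h2 : ∀ i < T + n, σ i < T + n) :
    ∃ ρ : FinPerm, (ρ.size : ℕ) = n ∧ (∀ i : Fin ρ.size, σ (T + i) = T + ρ.perm i) ∧
      ∀ i < n, ρ.rightInv i = rightInv (T + i) σ := by
  obtain ⟨n, rfl⟩ : ∃ k : ℕ+, (k : ℕ) = n := ⟨⟨n, hn⟩, rfl⟩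
  have hT : ∀ i, T ≤ σ (T + i) := fun i => by
    by_contra! h
    exact absurd (lt_of_apply_lt h1 h) (by omega)
  let f : Fin n → Fin n := fun i => ⟨σ (T + i) - T, by
    have := h2 (T + i) (by omega)
    have := hT i
    omega⟩
  have hf : Function.Injective f := by
    intro i j hij
    have h := congrArg Fin.val hij
    simp only [f] at h
    have hi := hT i
    have hj := hT j
    have := σ.injective (show σ (T + i) = σ (T + j) by omega)
    exact Fin.ext (by omega)
  let e : Equiv.Perm (Fin n) := Equiv.ofBijective f (Finite.injective_iff_bijective.1 hf)
  have he : ∀ i : Fin n, σ (T + i) = T + (e i : ℕ) := fun i => by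
    have hi := hT i
    change σ (T + i) = T + (σ (T + i) - T)
    omega
  refine ⟨⟨n, e⟩, rfl, he, fun i hi => ?_⟩
  have hinj : Function.Injective (fun j : Fin n => T + (j : ℕ)) := fun j k hjk =>
    Fin.ext (by simpa using hjk)
  rw [FinPerm.rightInv, rightInv, ← Set.ncard_image_of_injective _ hinj]
  congr 1
  ext j
  constructor
  · rintro ⟨j, ⟨hi', hij, hlt⟩, rfl⟩
    refine ⟨by simpa using hij, ?_⟩
    have h1 := he j
    have h2 := he ⟨i, hi⟩
    have h3 : (e j : ℕ) < e ⟨i, hi⟩ := hlt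
    simp only at h2 ⊢
    omega
  · rintro ⟨hij, hlt⟩
    have hj : j < T + n := lt_of_apply_lt h2 (hlt.trans (h2 _ (by omega)))
    refine ⟨⟨j - T, by omega⟩, ⟨hi, by change i < j - T; omega, ?_⟩, by
      change T + (j - T) = j; omega⟩
    have h1 := he ⟨j - T, by omega⟩
    have h2 := he ⟨i, hi⟩
    have h3 : T + (j - T) = j := by omega
    simp only [h3] at h1 h2
    change (e ⟨j - T, _⟩ : ℕ) < e ⟨i, hi⟩
    omega

lemma FinPerm.rightInv_of_size_le {ρ : FinPerm} {i : ℕ} (h : (ρ.size : ℕ) ≤ i) :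
    ρ.rightInv i = 0 := by
  rw [FinPerm.rightInv]
  convert! Set.ncard_empty (Fin ρ.size)
  ext j
  simp only [Set.mem_ofPred_eq, Set.mem_empty_iff_false, iff_false]
  rintro ⟨hi, -⟩
  omega

/-- The position where the `k`-th block of the code `a` starts. -/
noncomputable def cutPos (a : ℕ → ℕ) : ℕ → ℕ
  | 0 => 0
  | k + 1 => cutPos a k + firstCut (fun i => a (cutPos a k + i))

/-- Lowering a code preserves its cuts. This is used with `a` the counts at time `q` and `σ` the
permutation at an earlier time. -/
lemma forall_apply_cutPos_lt {σ : Equiv.Perm ℕ} {a : ℕ → ℕ} (ha : ∀ i, rightInv i σ ≤ a i)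
    (hpos : ∀ k, 0 < firstCut (fun i => a (cutPos a k + i))) (k : ℕ) :
    ∀ i < cutPos a k, σ i < cutPos a k := by
  rw [forall_apply_lt_iff]
  induction k with
  | zero => intro i hi; exact absurd hi (Nat.not_lt_zero i)
  | succ k ih =>
    intro i hi
    have hc := ((firstCut_eq_iff (hpos k)).1 rfl).1.2
    rw [cutPos] at hi ⊢
    by_cases h : i < cutPos a k
    · have := ih i h; omega
    · have h1 := hc (i - cutPos a k) (by omega)
      simp only [show cutPos a k + (i - cutPos a k) = i by omega] at h1
      have := ha i
      omega

/-- Minimality of the first cut makes the window before it a block; conversely, a longer block would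
have that window as a proper invariant initial segment, and a shorter one would end at an earlier
cut. -/
lemma isFirstBlock_iff {σ : Equiv.Perm ℕ} {ρ ρ' : FinPerm}
    (hpos : 0 < firstCut (fun i => rightInv i σ))
    (hs : (ρ'.size : ℕ) = firstCut (fun i => rightInv i σ))
    (hρ' : ∀ i : Fin ρ'.size, σ i = ρ'.perm i) : IsFirstBlock ρ σ ↔ ρ' = ρ := by
  obtain ⟨hc, hmin⟩ := (firstCut_eq_iff hpos).1 rfl
  rw [← hs] at hc hmin
  constructor
  · rintro ⟨hb, hρ⟩
    have hinv : ∀ i < (ρ.size : ℕ), σ i < ρ.size := fun i hi => by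
      have := hρ ⟨i, hi⟩
      simp only at this
      rw [this]
      exact Fin.is_lt _
    have hcut : IsCut (fun i => rightInv i σ) ρ.size := ⟨ρ.size.pos, (forall_apply_lt_iff σ _).1 hinv⟩
    have hsize : ρ'.size = ρ.size := by
      apply PNat.coe_injective
      refine le_antisymm (not_lt.1 fun h => hmin _ h hcut) (not_lt.1 fun h => ?_)
      refine hb ρ'.size ρ'.size.pos h fun i hi => ?_
      rw [← hρ i]
      exact (forall_apply_lt_iff σ _).2 hc.2 i hi
    obtain ⟨n, e⟩ := ρ
    obtain ⟨n', e'⟩ := ρ'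
    obtain rfl : n' = n := hsize
    congr 1
    ext i
    exact (hρ' i).symm.trans (hρ i)
  · rintro rfl
    refine ⟨fun m hm hlt hinv => hmin m hlt ⟨hm, (forall_apply_lt_iff σ m).1 fun i hi => ?_⟩, hρ'⟩
    have := hρ' ⟨i, hi.trans hlt⟩
    simp only at this
    rw [this]
    exact hinv _ hi

/-! ### Regeneration of an i.i.d. sequence at the cuts -/

section Regeneration

variable {E F : Type*} [MeasurableSpace E] [MeasurableSpace F]

/-- The law of an i.i.d. sequence. -/
noncomputable abbrev seqLaw (ξ : Measure E) : Measure (ℕ → E) := Measure.infinitePi fun _ => ξ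

/-- The length of the first block of a sequence whose entries are coded by `c`. -/
noncomputable def blockLen (c : E → ℕ) (x : ℕ → E) : ℕ := firstCut fun i => c (x i)

/-- Removal of the first block. -/
noncomputable def blockShift (c : E → ℕ) (x : ℕ → E) : ℕ → E := fun i => x (blockLen c x + i)

/-- A function of a sequence is determined by the first block. -/
def BlockDetermined (c : E → ℕ) (f : (ℕ → E) → F) : Prop :=
  ∀ x y, 0 < blockLen c x → (∀ i < blockLen c x, x i = y i) → f x = f y

lemma measurable_blockLen {c : E → ℕ} (hc : Measurable c) : Measurable (blockLen c) := by
  have hcut : ∀ m, MeasurableSet {x : ℕ → E | IsCut (fun i => c (x i)) m} := fun m => by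
    simp only [IsCut, Set.ofPred_and, Set.ofPred_forall]
    refine MeasurableSet.inter (MeasurableSet.const _) (MeasurableSet.iInter fun i =>
      MeasurableSet.iInter fun _ => ?_)
    exact measurableSet_lt (by fun_prop) measurable_const
  have hpos : ∀ n, 0 < n → MeasurableSet (blockLen c ⁻¹' {n}) := fun n hn => by
    have : blockLen c ⁻¹' {n} = {x | IsCut (fun i => c (x i)) n} ∩
        ⋂ m, ⋂ _ : m < n, {x | IsCut (fun i => c (x i)) m}ᶜ := by
      ext x
      simp only [Set.mem_inter_iff, Set.mem_iInter]
      exact firstCut_eq_iff hn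
    rw [this]
    exact (hcut n).inter (MeasurableSet.iInter fun m => MeasurableSet.iInter fun _ => (hcut m).compl)
  refine measurable_to_countable' fun n => ?_
  rcases Nat.eq_zero_or_pos n with rfl | hn
  · have : blockLen c ⁻¹' {0} = (⋃ n, ⋃ _ : 0 < n, blockLen c ⁻¹' {n})ᶜ := by
      ext x
      simp only [Set.mem_compl_iff, Set.mem_iUnion, Set.mem_preimage, Set.mem_singleton_iff,
        exists_prop, not_lt, Nat.le_zero, exists_eq_right']
    rw [this]
    exact (MeasurableSet.iUnion fun n => MeasurableSet.iUnion fun hn => hpos n hn).compl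
  · exact hpos n hn

lemma measurable_blockShift {c : E → ℕ} (hc : Measurable c) : Measurable (blockShift c) := by
  refine measurable_pi_iff.2 fun i => ?_
  have h : Measurable fun p : ℕ × (ℕ → E) => p.2 (p.1 + i) :=
    measurable_from_prod_countable_right fun n => measurable_pi_apply (n + i)
  exact h.comp ((measurable_blockLen hc).prodMk measurable_id)

lemma blockDetermined_blockLen {E : Type*} (c : E → ℕ) : BlockDetermined c (blockLen c) := fun _ _ hx h =>
  ((firstCut_congr hx fun i hi => by rw [h i hi]).1 rfl).symm

lemma measure_eq_tsum_inter_preimage {α : Type*} [MeasurableSpace α] (μ : Measure α) {N : α → ℕ}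
    (hN : Measurable N) {s : Set α} (hs : MeasurableSet s) :
    μ s = ∑' n, μ (s ∩ N ⁻¹' {n}) := by
  rw [← measure_iUnion]
  · congr 1
    ext x
    simp
  · intro m n hmn
    refine Set.disjoint_left.2 fun x hx hx' => hmn ?_
    exact hx.2.symm.trans hx'.2
  · exact fun n => hs.inter (hN (measurableSet_singleton n))

variable (ξ : Measure E) [IsProbabilityMeasure ξ]

lemma map_add_seqLaw (n : ℕ) : (seqLaw ξ).map (fun x i => x (n + i)) = seqLaw ξ :=
  Measure.map_infinitePi_infinitePi_of_inj (P := fun _ => ξ) (add_right_injective n)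

/-- Padding with `default` keeps the head a full sequence, so that block-determined functions can be
evaluated on it. -/
lemma indepFun_head_tail [Inhabited E] (n : ℕ) :
    IndepFun (fun (x : ℕ → E) i => if i < n then x i else default) (fun (x : ℕ → E) i => x (n + i))
      (seqLaw ξ) := by
  have h : iIndepFun (fun (i : ℕ) (x : ℕ → E) => x i) (seqLaw ξ) :=
    iIndepFun_infinitePi (X := fun _ e => e) fun _ => measurable_id
  have hd : Disjoint (Set.Iio n) (Set.Ici n) :=
    Set.disjoint_left.2 fun i hi hi' => absurd (show i < n from hi) (not_lt.2 hi')
  have hI := indep_iSup_of_disjoint (fun i => (measurable_pi_apply i).comap_le) h hd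
  rw [IndepFun_iff_Indep]
  refine indep_of_indep_of_le_left (indep_of_indep_of_le_right hI ?_) ?_
  · refine Measurable.comap_le ((@measurable_pi_iff _ _ _ (_) _ _).2 fun i => ?_)
    exact (comap_measurable _).mono (le_iSup₂_of_le (n + i) (Nat.le_add_right n i) le_rfl) le_rfl
  · refine Measurable.comap_le ((@measurable_pi_iff _ _ _ (_) _ _).2 fun i => ?_)
    by_cases hi : i < n
    · simp only [hi, if_true]
      exact (comap_measurable _).mono (le_iSup₂_of_le i hi le_rfl) le_rfl
    · simp only [hi, if_false]
      exact measurable_const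

variable {ξ} {c : E → ℕ}

/-- Strong Markov property at the first cut. On the event that the first block has length `n`, `f`
only sees the first `n` entries and the shifted sequence only the others. These are independent, and
the law of the others does not depend on `n`. -/
lemma measure_preimage_inter_blockShift [Inhabited E] (hc : Measurable c)
    (hN : ∀ᵐ x ∂seqLaw ξ, 0 < blockLen c x) {f : (ℕ → E) → F} (hf : Measurable f)
    (hfc : BlockDetermined c f) {A : Set F} (hA : MeasurableSet A) {D : Set (ℕ → E)}
    (hD : MeasurableSet D) :
    seqLaw ξ (f ⁻¹' A ∩ blockShift c ⁻¹' D) = seqLaw ξ (f ⁻¹' A) * seqLaw ξ D := by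
  have hL := measurable_blockLen hc
  rw [measure_eq_tsum_inter_preimage _ hL ((hf hA).inter (measurable_blockShift hc hD)),
    measure_eq_tsum_inter_preimage _ hL (hf hA), ← ENNReal.tsum_mul_right]
  refine tsum_congr fun n => ?_
  rcases Nat.eq_zero_or_pos n with rfl | hn
  · have h0 : seqLaw ξ (blockLen c ⁻¹' {0}) = 0 :=
      measure_mono_null (fun x hx => by simpa using hx) hN
    rw [measure_mono_null Set.inter_subset_right h0, measure_mono_null Set.inter_subset_right h0,
      zero_mul]
  · set tr : (ℕ → E) → ℕ → E := fun x i => if i < n then x i else default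
    have htr : ∀ x, ∀ i < n, x i = tr x i := fun x i hi => by simp [tr, hi]
    have h1 : f ⁻¹' A ∩ blockLen c ⁻¹' {n} = tr ⁻¹' (f ⁻¹' A ∩ blockLen c ⁻¹' {n}) := by
      ext x
      have hl : blockLen c x = n ↔ blockLen c (tr x) = n :=
        firstCut_congr hn fun i hi => by rw [htr x i hi]
      have hfx : blockLen c x = n → f x = f (tr x) := fun h =>
        hfc _ _ (h ▸ hn) fun i hi => htr x i (h ▸ hi)
      constructor
      · rintro ⟨h, h'⟩
        refine ⟨?_, hl.1 h'⟩
        change f (tr x) ∈ A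
        rw [← hfx h']
        exact h
      · rintro ⟨h, h'⟩
        refine ⟨?_, hl.2 h'⟩
        change f x ∈ A
        rw [hfx (hl.2 h')]
        exact h
    have h2 : f ⁻¹' A ∩ blockShift c ⁻¹' D ∩ blockLen c ⁻¹' {n} =
        tr ⁻¹' (f ⁻¹' A ∩ blockLen c ⁻¹' {n}) ∩ (fun x i => x (n + i)) ⁻¹' D := by
      rw [← h1]
      ext x
      constructor
      · rintro ⟨⟨h, h'⟩, hx : blockLen c x = n⟩
        refine ⟨⟨h, hx⟩, ?_⟩
        change blockShift c x ∈ D at h'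
        rw [← hx]
        exact h'
      · rintro ⟨⟨h, hx⟩, h'⟩
        have hx' : blockLen c x = n := hx
        refine ⟨⟨h, ?_⟩, hx⟩
        change (fun i => x (blockLen c x + i)) ∈ D
        rw [hx']
        exact h'
    rw [h2, (indepFun_head_tail ξ n).measure_inter_preimage_eq_mul _ _
      ((hf hA).inter (hL (measurableSet_singleton n))) hD, ← h1,
      ← Measure.map_apply (by fun_prop) hD, map_add_seqLaw]

lemma map_blockShift_seqLaw [Inhabited E] (hc : Measurable c)
    (hN : ∀ᵐ x ∂seqLaw ξ, 0 < blockLen c x) : (seqLaw ξ).map (blockShift c) = seqLaw ξ := by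
  ext D hD
  have := measure_preimage_inter_blockShift hc hN (measurable_blockLen hc)
    (blockDetermined_blockLen c) MeasurableSet.univ hD
  rw [Measure.map_apply (measurable_blockShift hc) hD]
  simpa using this

lemma map_iterate_blockShift_seqLaw [Inhabited E] (hc : Measurable c)
    (hN : ∀ᵐ x ∂seqLaw ξ, 0 < blockLen c x) (k : ℕ) :
    (seqLaw ξ).map ((blockShift c)^[k]) = seqLaw ξ := by
  have h : MeasurePreserving (blockShift c) (seqLaw ξ) (seqLaw ξ) :=
    ⟨measurable_blockShift hc, map_blockShift_seqLaw hc hN⟩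
  exact (h.iterate k).map_eq

/-- Induction on the number of blocks: the first one is split off, and what remains is an event of
the shifted sequence. -/
lemma iIndepFun_blocks [Inhabited E] (hc : Measurable c)
    (hN : ∀ᵐ x ∂seqLaw ξ, 0 < blockLen c x) {f : (ℕ → E) → F} (hf : Measurable f)
    (hfc : BlockDetermined c f) :
    iIndepFun (fun (k : ℕ) x => f ((blockShift c)^[k] x)) (seqLaw ξ) := by
  have hS := measurable_blockShift hc
  have key : ∀ (K : ℕ) (A : ℕ → Set F), (∀ k, MeasurableSet (A k)) →
      seqLaw ξ (⋂ k ∈ Finset.range K, (fun x => f ((blockShift c)^[k] x)) ⁻¹' A k) =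
        ∏ k ∈ Finset.range K, seqLaw ξ (f ⁻¹' A k) := by
    intro K
    induction K with
    | zero => intro A _; simp
    | succ K ih =>
      intro A hA
      have hD : MeasurableSet
          (⋂ k ∈ Finset.range K, (fun x => f ((blockShift c)^[k] x)) ⁻¹' A (k + 1)) :=
        Finset.measurableSet_biInter _ fun k _ => (hf.comp (hS.iterate k)) (hA _)
      have h1 : (⋂ k ∈ Finset.range (K + 1), (fun x => f ((blockShift c)^[k] x)) ⁻¹' A k) =
          f ⁻¹' A 0 ∩ blockShift c ⁻¹'
            (⋂ k ∈ Finset.range K, (fun x => f ((blockShift c)^[k] x)) ⁻¹' A (k + 1)) := by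
        ext x
        simp only [Set.mem_iInter, Set.mem_inter_iff, Set.mem_preimage, Finset.mem_range]
        constructor
        · exact fun h => ⟨h 0 (Nat.succ_pos K), fun k hk => h (k + 1) (Nat.succ_lt_succ hk)⟩
        · rintro ⟨h0, h⟩ k hk
          cases k with
          | zero => exact h0
          | succ k => exact h k (Nat.lt_of_succ_lt_succ hk)
      rw [h1, measure_preimage_inter_blockShift hc hN hf hfc (hA 0) hD, ih _ fun k => hA (k + 1),
        Finset.prod_range_succ', mul_comm]
  rw [iIndepFun_iff_measure_inter_preimage_eq_mul]
  intro s A hA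
  classical
  have hs : s ⊆ Finset.range (s.sup id + 1) := fun k hk =>
    Finset.mem_range.2 (Nat.lt_succ_of_le (Finset.le_sup (f := id) hk))
  -- Imposing no condition on the blocks outside `s` reduces to an initial segment of blocks.
  set A' : ℕ → Set F := fun k => if k ∈ s then A k else Set.univ
  have hA' : ∀ k, MeasurableSet (A' k) := fun k => by
    by_cases hk : k ∈ s
    · simpa [A', hk] using hA k hk
    · simp [A', hk]
  have h := key (s.sup id + 1) A' hA'
  rw [← Finset.prod_subset hs fun k _ hk => by simp [A', hk]] at h
  convert! h using 1
  · congr 1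
    ext x
    simp only [Set.mem_iInter, Set.mem_preimage]
    refine ⟨fun hx k _ => ?_, fun hx k hk => by simpa [A', hk] using hx k (hs hk)⟩
    by_cases hk : k ∈ s
    · simpa [A', hk] using hx k hk
    · simp [A', hk]
  · refine Finset.prod_congr rfl fun k hk => ?_
    -- Stationarity under the shift turns each factor into the marginal probability of the `k`-th
    -- block.
    have hm := map_iterate_blockShift_seqLaw hc hN k
    simp only [A', hk, if_true]
    conv_rhs => rw [← hm]
    rw [Measure.map_apply (hS.iterate k) (hf (hA k hk))]
    rfl

end Regeneration

/-! ### Almost sure existence of cuts -/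

lemma exists_pos_le_prod_one_sub_pow {q : ℝ} (h0 : 0 ≤ q) (h1 : q < 1) :
    ∃ δ > 0, ∀ m : ℕ, δ ≤ ∏ j ∈ Finset.range m, (1 - q ^ (j + 1)) := by
  have hf : ∀ j : ℕ, 0 < 1 - q ^ (j + 1) := fun j =>
    sub_pos.2 (pow_lt_one₀ h0 h1 (Nat.succ_ne_zero j))
  have hf1 : ∀ j : ℕ, 1 - q ^ (j + 1) ≤ 1 := fun j => sub_le_self _ (pow_nonneg h0 _)
  -- `K` makes the geometric tail `∑_{j ≥ K} q^(j+1)` less than `1/2`; the product of the factors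
  -- after the first `K` is then at least `1/2`, because `∏ (1 - x_j) ≥ 1 - ∑ x_j`.
  obtain ⟨K, hK⟩ : ∃ K : ℕ, q ^ K < (1 - q) / 2 :=
    exists_pow_lt_of_lt_one (by linarith) h1
  have hgeom : ∀ m : ℕ, 1 - q ^ (K + 1) * ((1 - q ^ m) / (1 - q)) ≤
      ∏ j ∈ Finset.range m, (1 - q ^ (K + j + 1)) := by
    intro m
    induction m with
    | zero => simp
    | succ m ih =>
      rw [Finset.prod_range_succ]
      have hq : 0 < 1 - q := by linarith
      have e : q ^ (K + 1) * ((1 - q ^ (m + 1)) / (1 - q)) =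
          q ^ (K + 1) * ((1 - q ^ m) / (1 - q)) + q ^ (K + m + 1) := by
        field_simp
        ring
      have hle : ∏ j ∈ Finset.range m, (1 - q ^ (K + j + 1)) ≤ 1 :=
        Finset.prod_le_one (fun j _ => (hf _).le) fun j _ => hf1 _
      have hp := pow_nonneg h0 (K + m + 1)
      rw [e]
      nlinarith
  have hhalf : ∀ m : ℕ, 1 / 2 ≤ ∏ j ∈ Finset.range m, (1 - q ^ (K + j + 1)) := fun m => by
    refine le_trans ?_ (hgeom m)
    have hq : 0 < 1 - q := by linarith
    have hm : (1 - q ^ m) / (1 - q) ≤ 1 / (1 - q) :=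
      div_le_div_of_nonneg_right (sub_le_self _ (pow_nonneg h0 m)) hq.le
    have hk : q ^ (K + 1) ≤ (1 - q) / 2 :=
      (pow_le_pow_of_le_one h0 h1.le (Nat.le_succ K)).trans hK.le
    have : q ^ (K + 1) * ((1 - q ^ m) / (1 - q)) ≤ (1 - q) / 2 * (1 / (1 - q)) :=
      (mul_le_mul_of_nonneg_left hm (pow_nonneg h0 _)).trans
        (mul_le_mul_of_nonneg_right hk (by positivity))
    have e : (1 - q) / 2 * (1 / (1 - q)) = 1 / 2 := by field_simp
    linarith
  have hpos : 0 < ∏ j ∈ Finset.range K, (1 - q ^ (j + 1)) := Finset.prod_pos fun j _ => hf j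
  refine ⟨(∏ j ∈ Finset.range K, (1 - q ^ (j + 1))) * (1 / 2), by positivity, fun m => ?_⟩
  calc _ ≤ (∏ j ∈ Finset.range K, (1 - q ^ (j + 1))) *
        ∏ j ∈ Finset.range m, (1 - q ^ (K + j + 1)) :=
        mul_le_mul_of_nonneg_left (hhalf m) hpos.le
    _ = ∏ j ∈ Finset.range (m + K), (1 - q ^ (j + 1)) := by
        rw [add_comm m K, Finset.prod_range_add]
    _ ≤ ∏ j ∈ Finset.range m, (1 - q ^ (j + 1)) := by
        rw [Finset.prod_range_add]
        exact mul_le_of_le_one_right (Finset.prod_nonneg fun j _ => (hf j).le)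
          (Finset.prod_le_one (fun j _ => (hf _).le) fun j _ => hf1 _)

section

variable {E : Type*} [MeasurableSpace E] {ξ : Measure E} [IsProbabilityMeasure ξ] {c : E → ℕ}

lemma measureReal_forall_add_lt (hc : Measurable c) {q : ℝ}
    (hq : ∀ n, ξ.real {e | c e < n} = 1 - q ^ n) (m : ℕ) :
    (seqLaw ξ).real {x | ∀ i < m, i + c (x i) < m} =
      ∏ j ∈ Finset.range m, (1 - q ^ (j + 1)) := by
  have h : {x : ℕ → E | ∀ i < m, i + c (x i) < m} =
      Set.pi (Finset.range m : Set ℕ) fun i => {e | c e < m - i} := by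
    ext x
    simp only [Set.mem_pi, Finset.coe_range, Set.mem_Iio]
    refine forall₂_congr fun i hi => ?_
    change _ ↔ c (x i) < m - i
    omega
  rw [measureReal_def, h, Measure.infinitePi_pi _ fun i _ => measurableSet_lt hc measurable_const,
    ENNReal.toReal_prod, ← Finset.prod_range_reflect]
  refine Finset.prod_congr rfl fun i hi => ?_
  rw [← measureReal_def, hq]
  have := Finset.mem_range.1 hi
  congr 2
  omega

/-- More is shown: a.s. there are infinitely many cuts. This event `L` is a tail event of
probability at least `δ`, so it has probability one. -/
lemma ae_blockLen_pos (hc : Measurable c) {q : ℝ} (h0 : 0 ≤ q) (h1 : q < 1)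
    (hq : ∀ n, ξ.real {e | c e < n} = 1 - q ^ n) : ∀ᵐ x ∂seqLaw ξ, 0 < blockLen c x := by
  -- `C n m` drops the constraints at positions below `n`. These hold for all large `m`, so
  -- infinitely many `m` satisfy `C n m` iff infinitely many are cuts; this is why `L` is in the
  -- tail σ-algebra.
  set C : ℕ → ℕ → Set (ℕ → E) := fun n m => {x | ∀ i < m, n ≤ i → i + c (x i) < m}
  set L : Set (ℕ → E) := ⋂ N : ℕ, ⋃ m : ℕ, ⋃ _ : N ≤ m, C 0 m
  have hLn : ∀ n, L = ⋂ N : ℕ, ⋃ m : ℕ, ⋃ _ : N ≤ m, C n m := by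
    intro n
    ext x
    simp only [L, C, Set.mem_iInter, Set.mem_iUnion, exists_prop]
    constructor
    · exact fun h N => (h N).imp fun m hm => ⟨hm.1, fun i hi _ => hm.2 i hi (Nat.zero_le i)⟩
    · intro h N
      obtain ⟨M, hM⟩ : ∃ M, ∀ i < n, i + c (x i) < M :=
        ⟨(Finset.range n).sup (fun i => i + c (x i)) + 1, fun i hi =>
          Nat.lt_succ_of_le (Finset.le_sup (f := fun i => i + c (x i)) (Finset.mem_range.2 hi))⟩
      obtain ⟨m, hm, hx⟩ := h (max N M)
      refine ⟨m, (le_max_left _ _).trans hm, fun i hi _ => ?_⟩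
      rcases lt_or_ge i n with hin | hin
      · exact (hM i hin).trans_le ((le_max_right _ _).trans hm)
      · exact hx i hi hin
  have hCm : ∀ n m, MeasurableSet[⨆ i ≥ n, MeasurableSpace.comap (fun x : ℕ → E => x i) inferInstance]
      (C n m) := by
    intro n m
    simp only [C, Set.ofPred_forall]
    refine MeasurableSet.iInter fun i => MeasurableSet.iInter fun _ => MeasurableSet.iInter fun hi => ?_
    refine (le_iSup₂_of_le (f := fun i (_ : i ≥ n) =>
      MeasurableSpace.comap (fun x : ℕ → E => x i) inferInstance) i hi le_rfl) _ ?_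
    exact ⟨{e | i + c e < m}, measurableSet_lt (measurable_const.add hc) measurable_const, rfl⟩
  have hle : ∀ i, MeasurableSpace.comap (fun x : ℕ → E => x i) inferInstance ≤
      (MeasurableSpace.pi : MeasurableSpace (ℕ → E)) := fun i => (measurable_pi_apply i).comap_le
  have hC : ∀ m, MeasurableSet (C 0 m) := fun m => (iSup₂_le fun i _ => hle i) _ (hCm 0 m)
  have hind : iIndepFun (fun (i : ℕ) (x : ℕ → E) => x i) (seqLaw ξ) :=
    iIndepFun_infinitePi (X := fun _ e => e) fun _ => measurable_id
  have h01 : seqLaw ξ L = 0 ∨ seqLaw ξ L = 1 := by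
    refine measure_zero_or_one_of_measurableSet_limsup_atTop hle hind ?_
    rw [limsup_eq_iInf_iSup_of_nat, MeasurableSpace.measurableSet_iInf]
    intro n
    rw [hLn n]
    exact MeasurableSet.iInter fun N => MeasurableSet.iUnion fun m => MeasurableSet.iUnion fun _ =>
      hCm n m
  obtain ⟨δ, hδ, hprod⟩ := exists_pos_le_prod_one_sub_pow h0 h1
  have hlow : ∀ m, ENNReal.ofReal δ ≤ seqLaw ξ (C 0 m) := fun m => by
    rw [← ofReal_measureReal]
    refine ENNReal.ofReal_le_ofReal ((hprod m).trans_eq ?_)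
    rw [← measureReal_forall_add_lt hc hq m]
    simp [C]
  -- Continuity from above: the unions over `m ≥ N` decrease in `N`, and each contains `C 0 N`.
  have hLpos : ENNReal.ofReal δ ≤ seqLaw ξ L := by
    refine ge_of_tendsto (tendsto_measure_iInter_atTop
      (fun N => (MeasurableSet.iUnion fun m => MeasurableSet.iUnion fun _ =>
        hC m).nullMeasurableSet) ?_ ⟨0, measure_ne_top _ _⟩) (Eventually.of_forall fun N => ?_)
    · intro N N' h
      exact Set.iUnion_mono fun m => Set.iUnion_subset fun hm => Set.subset_iUnion_of_subset
        (h.trans hm) le_rfl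
    · exact (hlow N).trans (measure_mono fun x hx => Set.mem_iUnion₂.2 ⟨N, le_rfl, hx⟩)
  have hL1 : seqLaw ξ L = 1 := h01.resolve_left fun h => by
    rw [h] at hLpos
    exact absurd (ENNReal.ofReal_pos.2 hδ) (not_lt.2 hLpos)
  have hLm : MeasurableSet L :=
    MeasurableSet.iInter fun N => MeasurableSet.iUnion fun m => MeasurableSet.iUnion fun _ => hC m
  filter_upwards [(mem_ae_iff_prob_eq_one hLm).2 hL1] with x hx
  obtain ⟨m, hm, hxm⟩ := Set.mem_iUnion₂.1 (Set.mem_iInter.1 hx 1)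
  have hcut : IsCut (fun i => c (x i)) m := ⟨hm, fun i hi => hxm i hi (Nat.zero_le i)⟩
  exact (Nat.sInf_mem (s := {m | IsCut (fun i => c (x i)) m}) ⟨m, hcut⟩ : IsCut _ _).1

end

/-! ### Birth processes with geometric marginals -/

section Birth

variable {Ω : Type*} [mΩ : MeasurableSpace Ω] {μ : Measure Ω} {X Y : UnitTime → Ω → ℕ}
  {p r : ℕ → UnitTime → ℝ}

/-- The σ-algebra of the past of `X` up to time `s`. -/
abbrev past (X : UnitTime → Ω → ℕ) (s : UnitTime) : MeasurableSpace Ω :=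
  ⨆ u : Set.Iic s, MeasurableSpace.comap (X u) inferInstance

omit mΩ in
lemma past_mono (X : UnitTime → Ω → ℕ) {s t : UnitTime} (h : s ≤ t) : past X s ≤ past X t :=
  iSup_le fun u => le_iSup (fun u : Set.Iic t => MeasurableSpace.comap (X u) inferInstance)
    ⟨u, u.2.trans h⟩

omit mΩ in
lemma measurable_past (X : UnitTime → Ω → ℕ) {s t : UnitTime} (h : s ≤ t) :
    Measurable[past X t] (X s) :=
  (comap_measurable (X s)).mono
    (le_iSup (fun u : Set.Iic t => MeasurableSpace.comap (X u) inferInstance) ⟨s, h⟩) le_rfl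

lemma IsMarkovProcess.past_le (hX : IsMarkovProcess μ X) (s : UnitTime) : past X s ≤ mΩ :=
  iSup_le fun u => (hX.measurable u).comap_le

lemma IsBirthProcess.measurableSet (hX : IsBirthProcess μ X p) {s : UnitTime} {A : Set Ω}
    (hA : MeasurableSet[past X s] A) : MeasurableSet A := hX.markov.past_le s A hA

lemma measurableSet_apply_eq {s : UnitTime} (hs : Measurable (X s)) (j : ℕ) :
    MeasurableSet {ω | X s ω = j} := hs (measurableSet_singleton j)

/-- The probability of `A ∩ {X t ≤ n}`. -/
noncomputable def cdfOn (μ : Measure Ω) (X : UnitTime → Ω → ℕ) (A : Set Ω) (n : ℕ)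
    (t : UnitTime) : ℝ := μ.real (A ∩ {ω | X t ω ≤ n})

lemma cdfOn_zero (A : Set Ω) (t : UnitTime) :
    cdfOn μ X A 0 t = μ.real (A ∩ {ω | X t ω = 0}) := by
  simp only [cdfOn, Nat.le_zero]

lemma IsBirthProcess.rates_right (hX : IsBirthProcess μ X p) (t : UnitTime) {j : ℕ}
    (hj : μ {ω | X t ω = j} ≠ 0) :
    ((fun v : UnitTime => transProb μ X t v j j - (1 - ((v : ℝ) - t) * p j t))
      =o[𝓝[>] t] fun v : UnitTime => (v : ℝ) - t) ∧
    (fun v : UnitTime => transProb μ X t v j (j + 1) - ((v : ℝ) - t) * p j t)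
      =o[𝓝[>] t] fun v : UnitTime => (v : ℝ) - t := by
  have hle : 𝓝[>] t ≤ 𝓝[admissible μ X t j] t := by
    refine nhdsWithin_mono t fun v (hv : t < v) => ⟨hv.ne', ?_⟩
    rw [min_eq_right hv.le]
    exact hj
  have habs : (fun s : UnitTime => |(s : ℝ) - t|) =ᶠ[𝓝[>] t] fun s => (s : ℝ) - t := by
    filter_upwards [self_mem_nhdsWithin] with v hv
    exact abs_of_pos (sub_pos.2 hv)
  refine ⟨((hX.rate_stay j t).mono hle).congr' ?_ habs, ((hX.rate_jump j t).mono hle).congr' ?_ habs⟩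
  all_goals
    filter_upwards [self_mem_nhdsWithin, habs] with v hv hv'
    rw [hv', min_eq_right (le_of_lt hv), max_eq_left (le_of_lt hv)]

lemma transProb_eq_div {s : UnitTime} (hs : Measurable (X s)) (t : UnitTime) (j k : ℕ) :
    transProb μ X s t j k =
      μ.real ({ω | X s ω = j} ∩ {ω | X t ω = k}) / μ.real {ω | X s ω = j} := by
  rw [transProb, measureReal_def, ProbabilityTheory.cond_apply (measurableSet_apply_eq hs j),
    ENNReal.toReal_mul, ENNReal.toReal_inv, ← measureReal_def, ← measureReal_def, div_eq_inv_mul]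

variable [IsProbabilityMeasure μ]

/-- The conditional expectation given `X s` is constant on `{X s = j}`. Integrating it over `A ∩ {X
s = j}` gives the product, and `A = Set.univ` identifies the constant as the transition probability.
-/
lemma IsMarkovProcess.measureReal_inter (hX : IsMarkovProcess μ X) {s t : UnitTime} (hst : s ≤ t)
    {A : Set Ω} (hA : MeasurableSet[past X s] A) (j k : ℕ) :
    μ.real (A ∩ {ω | X s ω = j} ∩ {ω | X t ω = k}) =
      μ.real (A ∩ {ω | X s ω = j}) * transProb μ X s t j k := by
  have hsm := hX.measurable s
  have hk : MeasurableSet {ω | X t ω = k} := hX.measurable t (measurableSet_singleton k)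
  by_cases h0 : μ.real {ω | X s ω = j} = 0
  · have h1 : μ.real (A ∩ {ω | X s ω = j}) = 0 :=
      measureReal_mono_null Set.inter_subset_right h0
    rw [h1, zero_mul]
    exact measureReal_mono_null Set.inter_subset_left h1
  set f : Ω → ℝ := {ω | X t ω = k}.indicator fun _ => (1 : ℝ) with hfdef
  have hf : Integrable f μ := (integrable_const 1).indicator hk
  set g : Ω → ℝ := μ[f | MeasurableSpace.comap (X s) inferInstance]
  have hfg : μ[f | past X s] =ᵐ[μ] g := hX.markov s t hst {k} (measurableSet_singleton k)
  have hgm : Measurable[MeasurableSpace.comap (X s) inferInstance] g :=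
    stronglyMeasurable_condExp.measurable
  -- Sets measurable for the σ-algebra of `X s` are preimages under `X s`, so a level set of `g`
  -- meeting a fibre contains it.
  obtain ⟨a, ha⟩ : ∃ a, ∀ ω, X s ω = j → g ω = a := by
    by_cases hne : ∃ ω, X s ω = j
    · obtain ⟨ω₀, h₀⟩ := hne
      refine ⟨g ω₀, fun ω hω => ?_⟩
      obtain ⟨B, -, hB⟩ := hgm (measurableSet_singleton (g ω₀))
      have h1 : ω₀ ∈ X s ⁻¹' B := by rw [hB]; rfl
      have h2 : ω ∈ X s ⁻¹' B := by
        change X s ω ∈ B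
        rw [hω, ← h₀]
        exact h1
      rw [hB] at h2
      exact h2
    · exact ⟨0, fun ω hω => absurd ⟨ω, hω⟩ hne⟩
  have key : ∀ A, MeasurableSet[past X s] A →
      μ.real (A ∩ {ω | X s ω = j} ∩ {ω | X t ω = k}) = μ.real (A ∩ {ω | X s ω = j}) * a := by
    intro A hA
    have hAj : MeasurableSet[past X s] (A ∩ {ω | X s ω = j}) :=
      hA.inter (measurable_past X le_rfl (measurableSet_singleton j))
    have hAj' := hX.past_le s _ hAj
    have h1 := setIntegral_condExp (hX.past_le s) hf hAj
    rw [hfdef, setIntegral_indicator hk, setIntegral_const, smul_eq_mul, mul_one, ← hfdef,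
      setIntegral_congr_ae (g := fun _ => a) hAj'
        (hfg.mono fun ω h hω => h.trans (ha ω hω.2)), setIntegral_const, smul_eq_mul] at h1
    exact h1.symm
  have hu := key Set.univ MeasurableSet.univ
  rw [Set.univ_inter] at hu
  rw [key A hA, transProb_eq_div hsm, hu, mul_div_cancel_left₀ _ h0]

/-! ### The forward equation for the mass below a level -/

lemma cdfOn_succ (hX : ∀ t, Measurable (X t)) {A : Set Ω} (hA : MeasurableSet A) (n : ℕ)
    (t : UnitTime) :
    cdfOn μ X A (n + 1) t = cdfOn μ X A n t + μ.real (A ∩ {ω | X t ω = n + 1}) := by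
  rw [cdfOn, cdfOn, ← measureReal_union _ (hA.inter (measurableSet_apply_eq (hX t) (n + 1)))]
  · congr 1
    ext ω
    simp only [Set.mem_inter_iff, Set.mem_union]
    rw [← and_or_left]
    exact and_congr_right fun _ => Nat.le_succ_iff
  · refine Set.disjoint_left.2 fun ω h h' => ?_
    have h1 : X t ω ≤ n := h.2
    have h2 : X t ω = n + 1 := h'.2
    omega

/-- The mass crossing the level `n` between the times `t` and `v`. -/
lemma IsBirthProcess.cdfOn_sub (hX : IsBirthProcess μ X p) (A : Set Ω) (n : ℕ)
    {t v : UnitTime} (htv : t ≤ v) :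
    cdfOn μ X A n t - cdfOn μ X A n v = μ.real (A ∩ {ω | X t ω ≤ n} ∩ {ω | n < X v ω}) := by
  have hm := hX.markov.measurable
  have hv : MeasurableSet {ω | X v ω ≤ n} := measurableSet_le (hm v) measurable_const
  have h1 : cdfOn μ X A n v = μ.real (A ∩ {ω | X t ω ≤ n} ∩ {ω | X v ω ≤ n}) := by
    refine measureReal_congr ?_
    filter_upwards [hX.monotone] with ω hω
    refine propext ⟨fun h => ⟨⟨h.1, (hω htv).trans h.2⟩, h.2⟩, fun h => ⟨h.1.1, h.2⟩⟩
  have h2 := measureReal_inter_add_sdiff (μ := μ) (s := A ∩ {ω | X t ω ≤ n}) hv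
  rw [← h1] at h2
  rw [cdfOn, ← h2, add_sub_cancel_left]
  congr 1
  ext ω
  simp [Set.mem_sdiff]

/-- The mass crossing level `n` inside `A` is at most the total crossing mass, so continuity of the
unrestricted distribution function passes to every `A`. -/
lemma IsBirthProcess.abs_cdfOn_sub_le (hX : IsBirthProcess μ X p) (A : Set Ω)
    (n : ℕ) (t v : UnitTime) :
    |cdfOn μ X A n t - cdfOn μ X A n v| ≤
      |cdfOn μ X Set.univ n t - cdfOn μ X Set.univ n v| := by
  have key : ∀ t v : UnitTime, t ≤ v → |cdfOn μ X A n t - cdfOn μ X A n v| ≤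
      |cdfOn μ X Set.univ n t - cdfOn μ X Set.univ n v| := by
    intro t v htv
    rw [hX.cdfOn_sub A n htv, hX.cdfOn_sub Set.univ n htv,
      abs_of_nonneg measureReal_nonneg, abs_of_nonneg measureReal_nonneg]
    exact measureReal_mono (Set.inter_subset_inter_left _
      (Set.inter_subset_inter_left _ (Set.subset_univ A)))
  rcases le_total t v with h | h
  · exact key t v h
  · rw [abs_sub_comm, abs_sub_comm (cdfOn μ X Set.univ n t)]
    exact key v t h

/-- Starting from `j < n`, the level `n` is crossed in a short time with small probability. -/
lemma IsBirthProcess.isLittleO_cross_of_lt (hX : IsBirthProcess μ X p) {t : UnitTime} {A : Set Ω}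
    (hA : MeasurableSet[past X t] A) {j n : ℕ} (hj : j < n) :
    (fun v : UnitTime => μ.real (A ∩ {ω | X t ω = j} ∩ {ω | n < X v ω}))
      =o[𝓝[>] t] fun v : UnitTime => (v : ℝ) - t := by
  have hm := hX.markov.measurable
  by_cases h0 : μ {ω | X t ω = j} = 0
  · have : ∀ v : UnitTime, μ.real (A ∩ {ω | X t ω = j} ∩ {ω | n < X v ω}) = 0 := fun v => by
      rw [measureReal_def, measure_mono_null _ h0, ENNReal.toReal_zero]
      exact fun ω hω => hω.1.2
    simp only [this]
    exact isLittleO_zero _ _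
  · obtain ⟨h1, h2⟩ := hX.rates_right t h0
    -- The rate terms cancel in the sum: staying in `j` or moving to `j + 1` has probability `1 -
    -- o(v - t)`, and neither passes `n` when `j < n`.
    have h3 := ((h1.add h2).const_mul_left (μ.real (A ∩ {ω | X t ω = j})))
    refine IsBigO.trans_isLittleO (IsBigO.of_bound 1 ?_) h3
    filter_upwards [self_mem_nhdsWithin] with v hv
    have htv : t ≤ v := le_of_lt hv
    have e1 := hX.markov.measureReal_inter htv hA j j
    have e2 := hX.markov.measureReal_inter htv hA j (j + 1)
    set a := A ∩ {ω | X t ω = j}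
    have ha : MeasurableSet a := (hX.measurableSet hA).inter (hm t (measurableSet_singleton j))
    have hsub : μ.real (a ∩ {ω | n < X v ω}) + μ.real (a ∩ {ω | X v ω = j + 1}) +
        μ.real (a ∩ {ω | X v ω = j}) ≤ μ.real a := by
      have m1 : MeasurableSet (a ∩ {ω | X v ω = j}) :=
        ha.inter (hm v (measurableSet_singleton _))
      have m2 : MeasurableSet (a ∩ {ω | X v ω = j + 1}) :=
        ha.inter (hm v (measurableSet_singleton _))
      rw [← measureReal_union _ m2, ← measureReal_union _ m1]
      · refine measureReal_mono ?_
        rintro ω ((h | h) | h) <;> exact h.1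
      · refine Set.disjoint_left.2 ?_
        rintro ω (h | h) h'
        · have u1 : n < X v ω := h.2
          have u2 : X v ω = j := h'.2
          omega
        · have u1 : X v ω = j + 1 := h.2
          have u2 : X v ω = j := h'.2
          omega
      · refine Set.disjoint_left.2 fun ω h h' => ?_
        have u1 : n < X v ω := h.2
        have u2 : X v ω = j + 1 := h'.2
        omega
    rw [one_mul, Real.norm_of_nonneg measureReal_nonneg, Real.norm_eq_abs]
    refine le_trans ?_ (neg_le_abs _)
    rw [e1, e2] at hsub
    linarith

lemma IsBirthProcess.isLittleO_cross_self (hX : IsBirthProcess μ X p) {t : UnitTime} {A : Set Ω}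
    (hA : MeasurableSet[past X t] A) (n : ℕ) :
    (fun v : UnitTime => μ.real (A ∩ {ω | X t ω = n} ∩ {ω | n < X v ω}) -
        ((v : ℝ) - t) * (p n t * μ.real (A ∩ {ω | X t ω = n})))
      =o[𝓝[>] t] fun v : UnitTime => (v : ℝ) - t := by
  have hm := hX.markov.measurable
  by_cases h0 : μ {ω | X t ω = n} = 0
  · have h1 : μ.real (A ∩ {ω | X t ω = n}) = 0 := by
      rw [measureReal_def, measure_mono_null Set.inter_subset_right h0, ENNReal.toReal_zero]
    have : ∀ v : UnitTime, μ.real (A ∩ {ω | X t ω = n} ∩ {ω | n < X v ω}) = 0 := fun v =>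
      measureReal_mono_null Set.inter_subset_left h1
    simp only [this, h1, mul_zero, sub_zero]
    exact isLittleO_zero _ _
  · obtain ⟨h1, -⟩ := hX.rates_right t h0
    refine (h1.const_mul_left (-μ.real (A ∩ {ω | X t ω = n}))).congr' ?_ EventuallyEq.rfl
    filter_upwards [self_mem_nhdsWithin] with v hv
    have htv : t ≤ v := le_of_lt hv
    have e1 := hX.markov.measureReal_inter htv hA n n
    set a := A ∩ {ω | X t ω = n}
    have hs := measureReal_inter_add_sdiff (μ := μ) (s := a)
      (measurableSet_apply_eq (hm v) n)
    have hd : μ.real (a \ {ω | X v ω = n}) = μ.real (a ∩ {ω | n < X v ω}) := by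
      refine measureReal_congr ?_
      filter_upwards [hX.monotone] with ω hω
      refine propext ⟨fun h => ⟨h.1, ?_⟩, fun h => ⟨h.1, ne_of_gt h.2⟩⟩
      have h1 : X t ω = n := h.1.2
      have h2 : X v ω ≠ n := h.2
      have h3 := hω htv
      change n < X v ω
      simp only at h3
      omega
    rw [hd, e1] at hs
    linear_combination -hs

/-- The crossing mass is split according to the state at time `t`. There are only finitely many
states up to `n`, and `n` alone contributes to first order. -/
lemma IsBirthProcess.isLittleO_cdfOn (hX : IsBirthProcess μ X p) {t : UnitTime} {A : Set Ω}
    (hA : MeasurableSet[past X t] A) (n : ℕ) :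
    (fun v : UnitTime => cdfOn μ X A n v - cdfOn μ X A n t -
        ((v : ℝ) - t) * -(p n t * μ.real (A ∩ {ω | X t ω = n})))
      =o[𝓝[>] t] fun v : UnitTime => (v : ℝ) - t := by
  have hm := hX.markov.measurable
  have hA' := hX.measurableSet hA
  have h1 : (fun v : UnitTime => ∑ j ∈ Finset.range n,
      μ.real (A ∩ {ω | X t ω = j} ∩ {ω | n < X v ω})) =o[𝓝[>] t] fun v : UnitTime => (v : ℝ) - t :=
    IsLittleO.fun_sum fun j hj => hX.isLittleO_cross_of_lt hA (Finset.mem_range.1 hj)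
  refine ((h1.add (hX.isLittleO_cross_self hA n)).neg_left).congr' ?_ EventuallyEq.rfl
  filter_upwards [self_mem_nhdsWithin] with v hv
  have h2 := hX.cdfOn_sub A n (le_of_lt hv : t ≤ v)
  have h3 : μ.real (A ∩ {ω | X t ω ≤ n} ∩ {ω | n < X v ω}) =
      ∑ j ∈ Finset.range (n + 1), μ.real (A ∩ {ω | X t ω = j} ∩ {ω | n < X v ω}) := by
    rw [← measureReal_biUnion_finset]
    · congr 1
      ext ω
      simp only [Set.mem_inter_iff, Set.mem_iUnion, Finset.mem_range, exists_prop]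
      constructor
      · rintro ⟨⟨h, h'⟩, h''⟩
        exact ⟨X t ω, Nat.lt_succ_of_le h', ⟨h, rfl⟩, h''⟩
      · rintro ⟨j, hj, ⟨h, h' : X t ω = j⟩, h''⟩
        exact ⟨⟨h, h'.trans_le (Nat.le_of_lt_succ hj)⟩, h''⟩
    · intro i _ j _ hij
      refine Set.disjoint_left.2 fun ω h h' => hij ?_
      exact (show X t ω = i from h.1.2).symm.trans h'.1.2
    · exact fun j _ => (hA'.inter (hm t (measurableSet_singleton j))).inter
        (measurableSet_lt measurable_const (hm v))
  rw [h3, Finset.sum_range_succ] at h2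
  linarith

/-- Extension of functions on `[0,1)` to the real line. -/
noncomputable def toUnit (x : ℝ) : UnitTime :=
  open Classical in if h : x ∈ Set.Ico (0 : ℝ) 1 then ⟨x, h⟩ else zeroTime

lemma coe_toUnit {x : ℝ} (h : x ∈ Set.Ico (0 : ℝ) 1) : (toUnit x : ℝ) = x := by
  rw [toUnit, dif_pos h]

lemma toUnit_coe (t : UnitTime) : toUnit t = t := Subtype.ext (coe_toUnit t.2)

lemma eventually_mem_Ico (t : UnitTime) : ∀ᶠ x in 𝓝[>] (t : ℝ), x ∈ Set.Ico (0 : ℝ) 1 := by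
  filter_upwards [Ioo_mem_nhdsGT t.2.2] with x hx
  exact ⟨t.2.1.trans hx.1.le, hx.2⟩

lemma tendsto_toUnit (t : UnitTime) : Tendsto toUnit (𝓝[>] (t : ℝ)) (𝓝[>] t) := by
  refine tendsto_nhdsWithin_iff.2 ⟨tendsto_subtype_rng.2 ?_, ?_⟩
  · refine (tendsto_nhdsWithin_of_tendsto_nhds tendsto_id).congr' ?_
    filter_upwards [eventually_mem_Ico t] with x hx
    exact (coe_toUnit hx).symm
  · filter_upwards [eventually_mem_Ico t, self_mem_nhdsWithin] with x hx hx'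
    change (t : ℝ) < toUnit x
    rw [coe_toUnit hx]
    exact hx'

lemma IsBirthProcess.hasDerivWithinAt_cdfOn (hX : IsBirthProcess μ X p) {t : UnitTime} {A : Set Ω}
    (hA : MeasurableSet[past X t] A) (n : ℕ) :
    HasDerivWithinAt (fun x => cdfOn μ X A n (toUnit x))
      (-(p n t * μ.real (A ∩ {ω | X t ω = n}))) (Set.Ici t) t := by
  rw [← hasDerivWithinAt_Ioi_iff_Ici, hasDerivWithinAt_iff_isLittleO]
  refine ((hX.isLittleO_cdfOn hA n).comp_tendsto (tendsto_toUnit t)).congr' ?_ ?_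
  all_goals
    filter_upwards [eventually_mem_Ico t] with x hx
    simp only [Function.comp_apply, coe_toUnit hx, toUnit_coe, smul_eq_mul]

/-- The marginal law at time `t` is geometric with parameter `1 - t`. -/
def GeometricMarginals (μ : Measure Ω) (X : UnitTime → Ω → ℕ) : Prop :=
  ∀ (t : UnitTime) (n : ℕ), μ.real {ω | X t ω = n} = (1 - t) * (t : ℝ) ^ n

/-! ### Uniqueness in law from geometric marginals -/

lemma GeometricMarginals.cdfOn_univ (hG : GeometricMarginals μ X) (hX : ∀ t, Measurable (X t))
    (n : ℕ) (t : UnitTime) : cdfOn μ X Set.univ n t = 1 - (t : ℝ) ^ (n + 1) := by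
  induction n with
  | zero => rw [cdfOn_zero, Set.univ_inter, hG]; ring
  | succ n ih => rw [cdfOn_succ hX MeasurableSet.univ, ih, Set.univ_inter, hG]; ring

/-- The marginals determine the rates. -/
lemma IsBirthProcess.rate_mul_pow (hX : IsBirthProcess μ X p) (hG : GeometricMarginals μ X)
    (n : ℕ) (t : UnitTime) : p n t * ((1 - t) * (t : ℝ) ^ n) = (n + 1) * (t : ℝ) ^ n := by
  have h1 := hX.hasDerivWithinAt_cdfOn (t := t) (A := Set.univ) MeasurableSet.univ n
  rw [Set.univ_inter, hG] at h1
  have h2 : HasDerivWithinAt (fun x : ℝ => 1 - x ^ (n + 1)) (-((n + 1 : ℕ) * (t : ℝ) ^ n))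
      (Set.Ioi (t : ℝ)) t := by
    simpa using ((hasDerivAt_pow (n + 1) (t : ℝ)).const_sub 1).hasDerivWithinAt
  have h3 : HasDerivWithinAt (fun x => cdfOn μ X Set.univ n (toUnit x))
      (-((n + 1 : ℕ) * (t : ℝ) ^ n)) (Set.Ioi (t : ℝ)) t := by
    refine h2.congr_of_eventuallyEq ?_ ?_
    · filter_upwards [eventually_mem_Ico t] with x hx
      rw [hG.cdfOn_univ hX.markov.measurable, coe_toUnit hx]
    · rw [hG.cdfOn_univ hX.markov.measurable, toUnit_coe]
  have := (uniqueDiffWithinAt_Ici (t : ℝ)).eq_deriv _ h1 (hasDerivWithinAt_Ioi_iff_Ici.1 h3)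
  push_cast at this
  linarith

lemma IsBirthProcess.rate_eq (hX : IsBirthProcess μ X p) (hG : GeometricMarginals μ X)
    {n : ℕ} {t : UnitTime} (h : μ {ω | X t ω = n} ≠ 0) : p n t = (n + 1) / (1 - t) := by
  have h1 := hX.rate_mul_pow hG n t
  have h2 : μ.real {ω | X t ω = n} ≠ 0 := (measureReal_ne_zero_iff).2 h
  rw [hG] at h2
  have ht : (t : ℝ) ^ n ≠ 0 := right_ne_zero_of_mul h2
  have h1t : (1 - (t : ℝ)) ≠ 0 := left_ne_zero_of_mul h2
  rw [eq_div_iff h1t]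
  exact mul_right_cancel₀ ht (by linear_combination h1)

/-- At a state of probability zero the rate is not determined, but there it multiplies zero. -/
lemma IsBirthProcess.hasDerivWithinAt_cdfOn' (hX : IsBirthProcess μ X p)
    (hG : GeometricMarginals μ X) {t : UnitTime} {A : Set Ω}
    (hA : MeasurableSet[past X t] A) (n : ℕ) :
    HasDerivWithinAt (fun x => cdfOn μ X A n (toUnit x))
      (-((n + 1) / (1 - t) * μ.real (A ∩ {ω | X t ω = n}))) (Set.Ici t) t := by
  have h := hX.hasDerivWithinAt_cdfOn hA n
  by_cases h0 : μ {ω | X t ω = n} = 0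
  · have h1 : μ.real (A ∩ {ω | X t ω = n}) = 0 := by
      rw [measureReal_def, measure_mono_null Set.inter_subset_right h0, ENNReal.toReal_zero]
    rw [h1, mul_zero] at h ⊢
    exact h
  · rwa [hX.rate_eq hG h0] at h

lemma IsBirthProcess.continuousOn_cdfOn (hX : IsBirthProcess μ X p)
    (hG : GeometricMarginals μ X) (A : Set Ω) (n : ℕ) :
    ContinuousOn (fun x => cdfOn μ X A n (toUnit x)) (Set.Ico 0 1) := by
  intro x hx
  refine tendsto_iff_norm_sub_tendsto_zero.2 ?_
  have h1 : Tendsto (fun y : ℝ => |y ^ (n + 1) - x ^ (n + 1)|) (𝓝[Set.Ico 0 1] x) (𝓝 0) := by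
    have : Continuous fun y : ℝ => |y ^ (n + 1) - x ^ (n + 1)| := by fun_prop
    have h := this.tendsto x
    rw [sub_self, abs_zero] at h
    exact tendsto_nhdsWithin_of_tendsto_nhds h
  refine squeeze_zero' (Eventually.of_forall fun _ => norm_nonneg _) ?_ h1
  filter_upwards [self_mem_nhdsWithin] with y hy
  refine (hX.abs_cdfOn_sub_le A n _ _).trans_eq ?_
  rw [hG.cdfOn_univ hX.markov.measurable, hG.cdfOn_univ hX.markov.measurable, coe_toUnit hx,
    coe_toUnit hy, abs_sub_comm]
  congr 1
  ring

/-- Two such processes which agree in law on `A` and `A'` at time `s` do so at later times. -/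
lemma IsBirthProcess.cdfOn_eq (hX : IsBirthProcess μ X p) (hGX : GeometricMarginals μ X)
    (hY : IsBirthProcess μ Y r) (hGY : GeometricMarginals μ Y) {s : UnitTime} {A A' : Set Ω}
    (hA : MeasurableSet[past X s] A) (hA' : MeasurableSet[past Y s] A')
    (h : ∀ n, cdfOn μ X A n s = cdfOn μ Y A' n s) (n : ℕ) {t : UnitTime} (hst : s ≤ t) :
    cdfOn μ X A n t = cdfOn μ Y A' n t := by
  -- The hypothesis is agreement at level `n - 1`, written so that it also makes sense, and is
  -- trivial, for `n = 0`.
  have step : ∀ n, (∀ t, s ≤ t → cdfOn μ X A n t - μ.real (A ∩ {ω | X t ω = n}) =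
      cdfOn μ Y A' n t - μ.real (A' ∩ {ω | Y t ω = n})) →
      ∀ t, s ≤ t → cdfOn μ X A n t = cdfOn μ Y A' n t := by
    intro n ih t hst
    -- The difference `D` of the two functions satisfies `D' = -(n+1)/(1-x) D`, so the integrating
    -- factor `(1-x)^(-(n+1))` makes it constant; it vanishes at `s`.
    set G : ℝ → ℝ := fun x => (cdfOn μ X A n (toUnit x) - cdfOn μ Y A' n (toUnit x)) *
      ((1 - x)⁻¹) ^ (n + 1)
    have hsub : Set.Icc (s : ℝ) t ⊆ Set.Ico 0 1 := fun x hx =>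
      ⟨s.2.1.trans hx.1, hx.2.trans_lt t.2.2⟩
    have hcont : ContinuousOn G (Set.Icc (s : ℝ) t) := by
      refine ContinuousOn.mul (((hX.continuousOn_cdfOn hGX A n).sub
        (hY.continuousOn_cdfOn hGY A' n)).mono hsub) ?_
      refine ContinuousOn.pow (ContinuousOn.inv₀ (by fun_prop) fun x hx => ?_) _
      have := (hsub hx).2
      linarith
    have hder : ∀ x ∈ Set.Ico (s : ℝ) t, HasDerivWithinAt G 0 (Set.Ici x) x := by
      intro x hx
      have hx1 : x < 1 := hx.2.trans t.2.2
      set u : UnitTime := ⟨x, s.2.1.trans hx.1, hx1⟩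
      have hsu : s ≤ u := hx.1
      have d1 := hX.hasDerivWithinAt_cdfOn' hGX (past_mono X hsu _ hA) n
      have d2 := hY.hasDerivWithinAt_cdfOn' hGY (past_mono Y hsu _ hA') n
      have hne : (1 - x) ≠ 0 := by linarith
      have d3 : HasDerivAt (fun y : ℝ => ((1 - y)⁻¹) ^ (n + 1))
          ((n + 1) * ((1 - x)⁻¹) ^ n * ((1 - x)⁻¹) ^ 2) x := by
        have := ((((hasDerivAt_id x).const_sub 1).inv hne).pow (n + 1))
        refine this.congr_deriv ?_
        simp
      have d := (d1.sub d2).mul d3.hasDerivWithinAt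
      refine d.congr_deriv ?_
      have e := ih u hsu
      have e3 : toUnit x = u := toUnit_coe u
      simp only [Pi.sub_apply, show (u : ℝ) = x from rfl, e3]
      have e2 : μ.real (A ∩ {ω | X u ω = n}) - μ.real (A' ∩ {ω | Y u ω = n}) =
          cdfOn μ X A n u - cdfOn μ Y A' n u := by linarith
      rw [div_eq_mul_inv]
      linear_combination (-(n + 1) * (1 - x)⁻¹ * (1 - x)⁻¹ ^ (n + 1)) * e2
    have hc := constant_of_has_deriv_right_zero hcont hder t ⟨hst, le_rfl⟩
    simp only [G, toUnit_coe, h n, sub_self, zero_mul] at hc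
    have ht : (1 - (t : ℝ)) ≠ 0 := by have := t.2.2; linarith
    exact sub_eq_zero.1 ((mul_eq_zero.1 hc).resolve_right (pow_ne_zero _ (inv_ne_zero ht)))
  have hmX := hX.markov.measurable
  have hmY := hY.markov.measurable
  induction n generalizing t with
  | zero =>
    refine step 0 (fun t _ => ?_) t hst
    rw [cdfOn_zero, cdfOn_zero, sub_self, sub_self]
  | succ n ih =>
    refine step (n + 1) (fun t ht => ?_) t hst
    rw [cdfOn_succ hmX (hX.measurableSet hA), cdfOn_succ hmY (hY.measurableSet hA'),
      add_sub_cancel_right, add_sub_cancel_right, ih ht]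

lemma IsBirthProcess.measureReal_inter_eq (hX : IsBirthProcess μ X p)
    (hGX : GeometricMarginals μ X) (hY : IsBirthProcess μ Y r) (hGY : GeometricMarginals μ Y)
    {s : UnitTime} {A A' : Set Ω} (hA : MeasurableSet[past X s] A)
    (hA' : MeasurableSet[past Y s] A') (h : ∀ n, cdfOn μ X A n s = cdfOn μ Y A' n s) (n : ℕ)
    {t : UnitTime} (hst : s ≤ t) :
    μ.real (A ∩ {ω | X t ω = n}) = μ.real (A' ∩ {ω | Y t ω = n}) := by
  have hc := fun n => hX.cdfOn_eq hGX hY hGY hA hA' h n hst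
  cases n with
  | zero => rw [← cdfOn_zero, ← cdfOn_zero, hc]
  | succ n =>
    have h1 := hc (n + 1)
    rw [cdfOn_succ hX.markov.measurable (hX.measurableSet hA),
      cdfOn_succ hY.markov.measurable (hY.measurableSet hA'), hc n] at h1
    exact add_left_cancel h1

/-- Times are added in increasing order. On the event fixed so far the state at the last time is
known, so the initial condition of the forward equation is a step function whose height is given by
induction. -/
lemma IsBirthProcess.finite_dim_eq (hX : IsBirthProcess μ X p)
    (hGX : GeometricMarginals μ X) (hY : IsBirthProcess μ Y r) (hGY : GeometricMarginals μ Y)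
    (I : Finset UnitTime) (a : UnitTime → ℕ) :
    μ.real {ω | ∀ t ∈ I, X t ω = a t} = μ.real {ω | ∀ t ∈ I, Y t ω = a t} := by
  have hpast : ∀ (Z : UnitTime → Ω → ℕ) (I : Finset UnitTime) (s : UnitTime), (∀ t ∈ I, t ≤ s) →
      MeasurableSet[past Z s] {ω | ∀ t ∈ I, Z t ω = a t} := by
    intro Z I s hs
    simp only [Set.ofPred_forall]
    exact Finset.measurableSet_biInter _ fun t ht =>
      measurable_past Z (hs t ht) (measurableSet_singleton (a t))
  have hins : ∀ (Z : UnitTime → Ω → ℕ) (m : UnitTime) (J : Finset UnitTime),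
      {ω | ∀ t ∈ insert m J, Z t ω = a t} = {ω | ∀ t ∈ J, Z t ω = a t} ∩ {ω | Z m ω = a m} := by
    intro Z m J
    ext ω
    simp only [Finset.forall_mem_insert, Set.ofPred_and, Set.mem_inter_iff]
    exact and_comm
  induction I using Finset.induction_on_max with
  | empty => simp
  | insert m I hI ih =>
    rw [hins X, hins Y]
    rcases I.eq_empty_or_nonempty with rfl | hne
    · simp [hGX m, hGY m]
    · have hs : ∀ t ∈ I, t ≤ I.max' hne := fun t ht => I.le_max' t ht
      have hmem := I.max'_mem hne
      have hcdf : ∀ (Z : UnitTime → Ω → ℕ) (n : ℕ),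
          cdfOn μ Z {ω | ∀ t ∈ I, Z t ω = a t} n (I.max' hne) =
            if a (I.max' hne) ≤ n then μ.real {ω | ∀ t ∈ I, Z t ω = a t} else 0 := by
        intro Z n
        rw [cdfOn]
        split_ifs with hn
        · congr 1
          ext ω
          refine ⟨fun h => h.1, fun h => ⟨h, ?_⟩⟩
          exact (h _ hmem).trans_le hn
        · convert! measureReal_empty (μ := μ)
          refine Set.eq_empty_of_forall_notMem fun ω h => hn ?_
          rw [← h.1 _ hmem]
          exact h.2
      refine hX.measureReal_inter_eq hGX hY hGY (hpast X I _ hs) (hpast Y I _ hs) (fun n => ?_) _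
        (hI _ hmem).le
      rw [hcdf, hcdf, ih]

/-- The law on path space is determined. -/
theorem IsBirthProcess.map_path_eq (hX : IsBirthProcess μ X p)
    (hGX : GeometricMarginals μ X) (hY : IsBirthProcess μ Y r) (hGY : GeometricMarginals μ Y) :
    μ.map (fun ω t => X t ω) = μ.map (fun ω t => Y t ω) := by
  have hmX : Measurable fun ω t => X t ω := measurable_pi_iff.2 hX.markov.measurable
  have hmY : Measurable fun ω t => Y t ω := measurable_pi_iff.2 hY.markov.measurable
  rw [map_eq_iff_forall_finset_map_restrict_eq hmX.aemeasurable hmY.aemeasurable]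
  intro I
  refine Measure.ext_of_singleton fun b => ?_
  classical
  set a : UnitTime → ℕ := fun t => if h : t ∈ I then b ⟨t, h⟩ else 0
  have hset : ∀ Z : UnitTime → Ω → ℕ, (fun ω => I.restrict (Z · ω)) ⁻¹' {b} =
      {ω | ∀ t ∈ I, Z t ω = a t} := by
    intro Z
    ext ω
    constructor
    · intro h t ht
      simp only [a, ht, dif_pos]
      exact congrFun h ⟨t, ht⟩
    · intro h
      refine funext fun t => ?_
      have := h t t.2
      simp only [a, t.2, dif_pos] at this
      exact this
  have happ : ∀ Z : UnitTime → Ω → ℕ, Measurable (fun ω t => Z t ω) →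
      μ.map (fun ω => I.restrict (Z · ω)) {b} = μ {ω | ∀ t ∈ I, Z t ω = a t} := fun Z hZ => by
    rw [← hset Z]
    exact Measure.map_apply ((Finset.measurable_restrict I).comp hZ) (measurableSet_singleton b)
  rw [happ X hmX, happ Y hmY, ← ENNReal.toReal_eq_toReal_iff' (measure_ne_top _ _) (measure_ne_top _ _)]
  exact hX.finite_dim_eq hGX hY hGY I a

/-- A birth process with geometric marginals is a shifted geometric birth process. -/
theorem IsBirthProcess.isGeometricBirthProcess (hX : IsBirthProcess μ X p)
    (hG : GeometricMarginals μ X) : IsGeometricBirthProcess μ fun t ω => X t ω + 1 := by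
  have hm := hX.markov.measurable
  have hcomap : ∀ u, MeasurableSpace.comap (fun ω => X u ω + 1) inferInstance =
      MeasurableSpace.comap (X u) inferInstance := by
    intro u
    refine le_antisymm ((comap_measurable (X u)).add_const 1).comap_le ?_
    rintro _ ⟨B, -, rfl⟩
    refine ⟨(fun n => n + 1) '' B, trivial, ?_⟩
    ext ω
    simp
  have hsucc : ∀ (s t : UnitTime) (j k : ℕ),
      transProb μ (fun t ω => X t ω + 1) s t (j + 1) (k + 1) = transProb μ X s t j k := by
    intro s t j k
    simp only [transProb, Nat.add_right_cancel_iff]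
  have hadm0 : ∀ t, admissible μ (fun t ω => X t ω + 1) t 0 = ∅ := by
    intro t
    refine Set.eq_empty_of_forall_notMem fun s hs => hs.2 ?_
    simp
  have hadm : ∀ t j, admissible μ (fun t ω => X t ω + 1) t (j + 1) = admissible μ X t j := by
    intro t j
    simp only [admissible, Nat.add_right_cancel_iff]
  -- A state has probability zero only at `t = 0` with `j ≠ 0`. By definition no time is then
  -- admissible, and the rate condition is void.
  have hrate : ∀ t j, 𝓝[admissible μ X t j] t = ⊥ ∨ p j t = ((j + 1 : ℕ) : ℝ) / (1 - t) := by
    intro t j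
    by_cases h : μ {ω | X t ω = j} = 0
    · left
      have h1 : μ.real {ω | X t ω = j} = 0 := by rw [measureReal_def, h, ENNReal.toReal_zero]
      rw [hG] at h1
      have h2 : (t : ℝ) = 0 ∧ j ≠ 0 := by
        rcases mul_eq_zero.1 h1 with h2 | h2
        · have := t.2.2; linarith
        · exact pow_eq_zero_iff'.1 h2
      have h3 : admissible μ X t j = ∅ := by
        refine Set.eq_empty_of_forall_notMem fun s hs => hs.2 ?_
        have hts : t ≤ s := by
          change (t : ℝ) ≤ s
          rw [h2.1]
          exact s.2.1
        rw [min_eq_right hts]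
        exact h
      rw [h3, nhdsWithin_empty]
    · right
      rw [hX.rate_eq hG h]
      push_cast
      rfl
  refine ⟨?_, ⟨⟨fun t => (hm t).add_const 1, ?_⟩, ?_, ?_, ?_, ?_, ?_⟩⟩
  · have h0 : μ.real {ω | X zeroTime ω = 0} = 1 := by
      rw [hG]; simp [zeroTime]
    have h1 : μ {ω | X zeroTime ω = 0} = 1 := by
      rw [← ofReal_measureReal, h0, ENNReal.ofReal_one]
    filter_upwards [(mem_ae_iff_prob_eq_one (hm zeroTime (measurableSet_singleton 0))).2 h1] with ω hω
    rw [show X zeroTime ω = 0 from hω]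
  · intro s t hst A hA
    have := hX.markov.markov s t hst ((fun n => n + 1) ⁻¹' A) trivial
    simp only [hcomap]
    exact this
  · filter_upwards [hX.cadlag] with ω hω t
    obtain ⟨h1, l, h2⟩ := hω t
    exact ⟨(continuous_of_discreteTopology (f := fun n : ℕ => n + 1)).continuousAt.comp_continuousWithinAt
      h1, l + 1, ((continuous_of_discreteTopology (f := fun n : ℕ => n + 1)).tendsto l).comp h2⟩
  · filter_upwards [hX.monotone] with ω hω s t hst
    exact Nat.add_le_add_right (hω hst) 1
  · exact fun j t => div_nonneg (Nat.cast_nonneg j) (sub_nonneg.2 t.2.2.le)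
  · intro j t
    cases j with
    | zero => rw [hadm0, nhdsWithin_empty]; exact isLittleO_bot _ _
    | succ j =>
      simp only [hsucc, hadm]
      rcases hrate t j with h | h
      · rw [h]; exact isLittleO_bot _ _
      · rw [← h]; exact hX.rate_stay j t
  · intro j t
    cases j with
    | zero => rw [hadm0, nhdsWithin_empty]; exact isLittleO_bot _ _
    | succ j =>
      simp only [hsucc, hadm]
      rcases hrate t j with h | h
      · rw [h]; exact isLittleO_bot _ _
      · rw [← h]; exact hX.rate_jump j t

end Birth

/-! ### The blocks of a continuous-time Mallows process -/

/-- The paths of all right-inversion counts. -/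
noncomputable def invPaths {Ω : Type*} (S : UnitTime → Ω → Equiv.Perm ℕ) (ω : Ω) :
    ℕ → UnitTime → ℕ := fun i t => rightInv i (S t ω)

/-- The value of a path at time `q`. -/
abbrev valueAt (q : UnitTime) (e : UnitTime → ℕ) : ℕ := e q

lemma measurable_valueAt (q : UnitTime) : Measurable (valueAt q) := measurable_pi_apply q

/-- The path of the first block, in terms of the paths of the right-inversion counts. -/
noncomputable def blockPath (q : UnitTime) (x : ℕ → UnitTime → ℕ) (t : Set.Iic q) : FinPerm :=
  decode (blockLen (valueAt q) x) fun i => x i t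

/-- The `k`-th block at time `t ≤ q`, for the division into blocks at time `q`. -/
noncomputable def block {Ω : Type*} (S : UnitTime → Ω → Equiv.Perm ℕ) (q : UnitTime) (k : ℕ)
    (t : Set.Iic q) (ω : Ω) : FinPerm :=
  blockPath q ((blockShift (valueAt q))^[k] (invPaths S ω)) t

lemma measurable_blockPath (q : UnitTime) : Measurable (blockPath q) := by
  refine measurable_pi_iff.2 fun t => ?_
  have h : Measurable fun p : ℕ × (ℕ → UnitTime → ℕ) => decode p.1 fun i => p.2 i t :=
    measurable_from_prod_countable_right fun n => by
      -- The domain `Fin n → ℕ` is countable, so the choice made in `decode` is harmless.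
      have h1 : Measurable (decode n) := measurable_of_countable _
      have h2 : Measurable fun (x : ℕ → UnitTime → ℕ) (i : Fin n) => x i t := by fun_prop
      exact h1.comp h2
  exact h.comp ((measurable_blockLen (measurable_valueAt q)).prodMk measurable_id)

lemma blockDetermined_blockPath (q : UnitTime) : BlockDetermined (valueAt q) (blockPath q) := by
  intro x y hx h
  have hn := blockDetermined_blockLen (valueAt q) x y hx h
  funext t
  have : ∀ n m, n = m → (∀ i < n, x i = y i) →
      decode n (fun i => x i t) = decode m fun i => y i t := by
    rintro n _ rfl hi
    congr 1
    funext i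
    rw [hi i i.2]
  exact this _ _ hn h

lemma iterate_blockShift {E : Type*} (c : E → ℕ) (x : ℕ → E) (k : ℕ) :
    (blockShift c)^[k] x = fun i => x (cutPos (fun i => c (x i)) k + i) := by
  induction k with
  | zero => simp [cutPos]
  | succ k ih =>
    rw [Function.iterate_succ_apply', ih]
    funext i
    rw [cutPos, add_assoc]
    rfl

/-- On a single path: the blocks decompose `S t ω`, and their right-inversion counts are those
of `S t ω`. -/
lemma block_spec {Ω : Type*} {S : UnitTime → Ω → Equiv.Perm ℕ} {q : UnitTime} {ω : Ω}
    (hmono : ∀ i, Monotone fun t => rightInv i (S t ω))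
    (hpos : ∀ k, 0 < blockLen (valueAt q) ((blockShift (valueAt q))^[k] (invPaths S ω)))
    (k : ℕ) (t : Set.Iic q) :
    ((block S q k t ω).size : ℕ) =
        blockLen (valueAt q) ((blockShift (valueAt q))^[k] (invPaths S ω)) ∧
      (∀ i : Fin (block S q k t ω).size,
        S t ω (cutPos (fun i => rightInv i (S q ω)) k + i) =
          cutPos (fun i => rightInv i (S q ω)) k + (block S q k t ω).perm i) ∧
      ∀ i < ((block S q k t ω).size : ℕ), (block S q k t ω).rightInv i =
        (blockShift (valueAt q))^[k] (invPaths S ω) i t := by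
  set a : ℕ → ℕ := fun i => rightInv i (S q ω)
  have hx : ∀ k, (blockShift (valueAt q))^[k] (invPaths S ω) =
      fun i => invPaths S ω (cutPos a k + i) := fun k => iterate_blockShift _ _ k
  have hlen : ∀ k, blockLen (valueAt q) ((blockShift (valueAt q))^[k] (invPaths S ω)) =
      firstCut fun i => a (cutPos a k + i) := fun k => by rw [hx]; rfl
  have hpos' : ∀ k, 0 < firstCut fun i => a (cutPos a k + i) := fun k => hlen k ▸ hpos k
  -- Monotonicity in time enters here: the cuts at time `q` are invariant for `S t ω`.
  have hinv := forall_apply_cutPos_lt (σ := S t ω) (fun i => hmono i t.2) hpos'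
  obtain ⟨ρ, h1, h2, h3⟩ := exists_window (hpos' k) (hinv k) (hinv (k + 1))
  have hB : block S q k t ω = ρ := by
    refine decode_eq (h1.trans (hlen k).symm) fun i => ?_
    rw [h3 i (by rw [← hlen]; exact i.2)]
    exact (congrFun (congrFun (hx k) i) t).symm
  rw [hB, hlen]
  refine ⟨h1, h2, fun i hi => ?_⟩
  rw [h3 i (h1 ▸ hi), hx]
  rfl

lemma isDirectSum_block {Ω : Type*} {S : UnitTime → Ω → Equiv.Perm ℕ} {q : UnitTime} {ω : Ω}
    (hmono : ∀ i, Monotone fun t => rightInv i (S t ω))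
    (hpos : ∀ k, 0 < blockLen (valueAt q) ((blockShift (valueAt q))^[k] (invPaths S ω)))
    (t : Set.Iic q) : IsDirectSum (S t ω) fun k => block S q k t ω := by
  have hoff : ∀ k, offset (fun k => block S q k t ω) k =
      cutPos (fun i => rightInv i (S q ω)) k := by
    intro k
    induction k with
    | zero => simp [offset, cutPos]
    | succ k ih =>
      rw [offset] at ih
      rw [offset, Finset.sum_range_succ, ih, cutPos, (block_spec hmono hpos k t).1,
        iterate_blockShift]
      rfl
  intro k i
  rw [hoff]
  exact (block_spec hmono hpos k t).2.1 i

lemma measurableSet_isFirstBlock (ρ : FinPerm) :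
    MeasurableSet {σ : Equiv.Perm ℕ | IsFirstBlock ρ σ} := by
  have hev : ∀ i : ℕ, Measurable fun σ : Equiv.Perm ℕ => σ i := fun i =>
    (measurable_pi_apply i).comp (comap_measurable fun (σ : Equiv.Perm ℕ) (i : ℕ) => σ i)
  simp only [IsFirstBlock, Set.ofPred_and, Set.ofPred_forall]
  exact (MeasurableSet.const _).inter (MeasurableSet.iInter fun i =>
    hev i (measurableSet_singleton _))

section Mallows

variable {Ω : Type u} [MeasurableSpace Ω] {μ : Measure Ω} {S : UnitTime → Ω → Equiv.Perm ℕ}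
  (hS : IsContinuousMallows μ S)

include hS

/-! ### The count paths as an i.i.d. sequence -/

lemma IsContinuousMallows.measurable_invPath (i : ℕ) : Measurable fun ω => invPaths S ω i := by
  obtain ⟨p, hp⟩ := hS.birth i
  exact measurable_pi_iff.2 hp.markov.measurable

lemma IsContinuousMallows.measurable_invPaths : Measurable (invPaths S) :=
  measurable_pi_iff.2 hS.measurable_invPath

lemma IsContinuousMallows.geometricMarginals (i : ℕ) :
    GeometricMarginals μ fun t ω => rightInv i (S t ω) := by
  intro t n
  obtain ⟨p, hp⟩ := hS.birth i
  have hlaw := (hS.marginal t).geometric i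
  have h1 := hlaw.map_eq
  rw [AEMeasurable.map_map_of_aemeasurable hlaw.aemeasurable
    (hS.markov.measurable t).aemeasurable] at h1
  have h2 : μ.real {ω | rightInv i (S t ω) = n} = (geometricMeasure (oneSub t)).real {n} := by
    rw [← h1]
    exact (map_measureReal_apply (hp.markov.measurable t) (measurableSet_singleton n)).symm
  have hne : oneSub t ≠ 0 := by
    intro h
    have h' := congrArg Subtype.val h
    simp only [oneSub, unitInterval.coe_symm_eq, Set.Icc.coe_zero] at h'
    have := t.2.2
    linarith
  rw [h2, geometricMeasure_real_singleton hne]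
  simp only [oneSub, unitInterval.coe_symm_eq, sub_sub_cancel]
  ring

lemma IsContinuousMallows.measurable_shift (q : UnitTime) (k : ℕ) :
    Measurable fun ω => (blockShift (valueAt q))^[k] (invPaths S ω) :=
  ((measurable_blockShift (measurable_valueAt q)).iterate k).comp hS.measurable_invPaths

lemma IsContinuousMallows.measurable_block (q : UnitTime) (k : ℕ) :
    Measurable fun ω t => block S q k t ω :=
  (measurable_blockPath q).comp (hS.measurable_shift q k)

lemma IsContinuousMallows.measurable_block_apply (q : UnitTime) (k : ℕ) (t : Set.Iic q) :
    Measurable (block S q k t) :=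
  measurable_pi_iff.1 (hS.measurable_block q k) t

variable [IsProbabilityMeasure μ]

/-- The rates may a priori differ between indices; the common geometric marginals exclude any effect
on the law. -/
lemma IsContinuousMallows.map_invPath (i : ℕ) :
    μ.map (fun ω => invPaths S ω i) = μ.map fun ω => invPaths S ω 0 := by
  obtain ⟨p, hp⟩ := hS.birth i
  obtain ⟨r, hr⟩ := hS.birth 0
  exact hp.map_path_eq (hS.geometricMarginals i) hr (hS.geometricMarginals 0)

lemma IsContinuousMallows.map_invPaths :
    μ.map (invPaths S) = seqLaw (μ.map fun ω => invPaths S ω 0) := by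
  have h : iIndepFun (fun (i : ℕ) ω => invPaths S ω i) μ := hS.indep
  refine (h.map_fun_eq_infinitePi_map hS.measurable_invPath).trans ?_
  simp only [hS.map_invPath]

lemma IsContinuousMallows.isProbabilityMeasure_map :
    IsProbabilityMeasure (μ.map fun ω => invPaths S ω 0) :=
  Measure.isProbabilityMeasure_map (hS.measurable_invPath 0).aemeasurable

lemma IsContinuousMallows.ae_blockLen_pos (q : UnitTime) :
    ∀ᵐ x ∂seqLaw (μ.map fun ω => invPaths S ω 0), 0 < blockLen (valueAt q) x := by
  have := hS.isProbabilityMeasure_map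
  refine MallowsProcess.ae_blockLen_pos (measurable_valueAt q) q.2.1 q.2.2 fun n => ?_
  rw [map_measureReal_apply (hS.measurable_invPath 0)
    (measurableSet_lt (measurable_valueAt q) measurable_const)]
  obtain ⟨p, hp⟩ := hS.birth 0
  cases n with
  | zero => simp
  | succ n =>
    rw [← (hS.geometricMarginals 0).cdfOn_univ hp.markov.measurable, cdfOn, Set.univ_inter]
    congr 1
    ext ω
    exact Nat.lt_succ_iff

/-- The paths of the right-inversion counts from the `k`-th block on have the same law as all of
them. -/
lemma IsContinuousMallows.map_shift (q : UnitTime) (k : ℕ) :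
    μ.map (fun ω => (blockShift (valueAt q))^[k] (invPaths S ω)) =
      seqLaw (μ.map fun ω => invPaths S ω 0) := by
  have := hS.isProbabilityMeasure_map
  have hm := (measurable_blockShift (measurable_valueAt q)).iterate k
  rw [← map_iterate_blockShift_seqLaw (measurable_valueAt q) (hS.ae_blockLen_pos q) k,
    ← hS.map_invPaths, Measure.map_map hm hS.measurable_invPaths]
  rfl

lemma IsContinuousMallows.ae_good (q : UnitTime) :
    ∀ᵐ ω ∂μ, (∀ i, Monotone fun t => rightInv i (S t ω)) ∧
      ∀ k, 0 < blockLen (valueAt q) ((blockShift (valueAt q))^[k] (invPaths S ω)) := by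
  refine Filter.Eventually.and (ae_all_iff.2 fun i => ?_) (ae_all_iff.2 fun k => ?_)
  · obtain ⟨p, hp⟩ := hS.birth i
    exact hp.monotone
  · refine ae_of_ae_map (p := fun x => 0 < blockLen (valueAt q) x)
      (hS.measurable_shift q k).aemeasurable ?_
    rw [hS.map_shift q k]
    exact hS.ae_blockLen_pos q

lemma IsContinuousMallows.identDistrib_block (q : UnitTime) (k : ℕ) :
    IdentDistrib (fun ω t => block S q k t ω) (fun ω t => block S q 0 t ω) μ μ := by
  refine ⟨(hS.measurable_block q k).aemeasurable, (hS.measurable_block q 0).aemeasurable, ?_⟩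
  have h : ∀ k, μ.map (fun ω t => block S q k t ω) =
      (seqLaw (μ.map fun ω => invPaths S ω 0)).map (blockPath q) := fun k => by
    rw [← hS.map_shift q k, Measure.map_map (measurable_blockPath q) (hS.measurable_shift q k)]
    rfl
  rw [h, h]

lemma IsContinuousMallows.iIndepFun_block (q : UnitTime) :
    iIndepFun (fun (k : ℕ) ω t => block S q k t ω) μ := by
  have := hS.isProbabilityMeasure_map
  have h := iIndepFun_blocks (measurable_valueAt q) (hS.ae_blockLen_pos q)
    (measurable_blockPath q) (blockDetermined_blockPath q)
  rw [← hS.map_invPaths] at h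
  have hm : ∀ k, Measurable fun x => blockPath q ((blockShift (valueAt q))^[k] x) := fun k =>
    (measurable_blockPath q).comp ((measurable_blockShift (measurable_valueAt q)).iterate k)
  rw [iIndepFun_iff_measure_inter_preimage_eq_mul] at h ⊢
  intro s A hA
  have h1 := h s hA
  rw [Measure.map_apply hS.measurable_invPaths
    (Finset.measurableSet_biInter _ fun k hk => hm k (hA k hk))] at h1
  simp only [Set.preimage_iInter] at h1
  refine h1.trans (Finset.prod_congr rfl fun k hk => ?_)
  rw [Measure.map_apply hS.measurable_invPaths (hm k (hA k hk))]
  rfl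

lemma IsContinuousMallows.cadlag_block (q : UnitTime) (k : ℕ) :
    ∀ᵐ ω ∂μ, ∀ i, IsCadlag fun t => (block S q k t ω).rightInv i := by
  have hc : ∀ᵐ ω ∂μ, ∀ i, IsCadlag fun t => rightInv i (S t ω) := ae_all_iff.2 fun i => by
    obtain ⟨p, hp⟩ := hS.birth i
    exact hp.cadlag
  filter_upwards [hS.ae_good q, hc] with ω ⟨hmono, hpos⟩ hcad i
  have hspec := fun t => block_spec hmono hpos k t
  by_cases hi : i < blockLen (valueAt q) ((blockShift (valueAt q))^[k] (invPaths S ω))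
  · have h : (fun t => (block S q k t ω).rightInv i) = fun t : Set.Iic q =>
        rightInv (cutPos (fun i => rightInv i (S q ω)) k + i) (S t ω) := by
      funext t
      rw [(hspec t).2.2 i (by rw [(hspec t).1]; exact hi), iterate_blockShift]
      rfl
    rw [h]
    intro t
    obtain ⟨h1, l, h2⟩ := hcad (cutPos (fun i => rightInv i (S q ω)) k + i) t
    refine ⟨h1.comp continuous_subtype_val.continuousWithinAt fun s hs => hs, l, h2.comp ?_⟩
    exact tendsto_nhdsWithin_iff.2 ⟨tendsto_nhdsWithin_of_tendsto_nhds
      (continuous_subtype_val.tendsto t), by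
        filter_upwards [self_mem_nhdsWithin] with s hs using hs⟩
  · have h : (fun t => (block S q k t ω).rightInv i) = fun _ => 0 := by
      funext t
      exact FinPerm.rightInv_of_size_le (by rw [(hspec t).1]; exact not_lt.1 hi)
    rw [h]
    exact fun t => ⟨continuousWithinAt_const, 0, tendsto_const_nhds⟩

/-! ### Laws of the blocks, at time `q` and conditionally on the final value -/

lemma IsContinuousMallows.isMallowsBlock (q : UnitTime) (k : ℕ) :
    IsMallowsBlock q (μ.map (block S q k (endTime q))) := by
  refine ⟨μ.map (S q), hS.marginal q, fun ρ => ?_⟩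
  have h0 : μ.map (block S q k (endTime q)) = μ.map (block S q 0 (endTime q)) :=
    ((hS.identDistrib_block q k).comp (measurable_pi_apply (endTime q))).map_eq
  rw [h0, Measure.map_apply (hS.measurable_block_apply q 0 _) trivial,
    Measure.map_apply (hS.markov.measurable q) (measurableSet_isFirstBlock ρ)]
  refine measure_congr ?_
  filter_upwards [hS.ae_good q] with ω ⟨hmono, hpos⟩
  have hspec := block_spec hmono hpos 0 (endTime q)
  refine propext (isFirstBlock_iff (hpos 0) hspec.1 fun i => ?_).symm
  have := hspec.2.1 i
  simpa [cutPos, endTime] using this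

/-- The event that the `k`-th block at time `q` is `ρ`, in terms of right-inversion counts. -/
lemma IsContinuousMallows.ae_block_eq_iff (q : UnitTime) (k : ℕ) (ρ : FinPerm)
    (hρ : μ {ω | block S q k (endTime q) ω = ρ} ≠ 0) :
    ∀ᵐ ω ∂μ, (block S q k (endTime q) ω = ρ ↔ ∀ i : Fin ρ.size,
      (blockShift (valueAt q))^[k] (invPaths S ω) i q = ρ.rightInv i) := by
  -- Positive probability yields one good outcome with block `ρ`, so the counts of `ρ` have their
  -- first cut at its size. Any good outcome with the same counts then has the same block length.
  obtain ⟨ω₀, h₀, hmono₀, hpos₀⟩ := ((frequently_ae_iff.2 hρ).and_eventually (hS.ae_good q)).exists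
  have hspec₀ := block_spec hmono₀ hpos₀ k (endTime q)
  rw [h₀] at hspec₀
  filter_upwards [hS.ae_good q] with ω ⟨hmono, hpos⟩
  constructor
  · rintro rfl i
    exact ((block_spec hmono hpos k (endTime q)).2.2 i i.2).symm
  · intro h
    have hlen : blockLen (valueAt q) ((blockShift (valueAt q))^[k] (invPaths S ω)) = ρ.size := by
      refine (firstCut_congr ρ.size.pos fun i hi => ?_).1 hspec₀.1.symm
      exact (hspec₀.2.2 i hi).symm.trans (h ⟨i, hi⟩).symm
    refine decode_eq hlen.symm fun i => ?_
    have hi : (i : ℕ) < ρ.size := by rw [← hlen]; exact i.2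
    exact (h ⟨i, hi⟩).symm

/-- Fixing the block at time `q` constrains each of the first `|ρ|` paths separately, and these
paths are i.i.d. -/
lemma IsContinuousMallows.measure_block_eq_inter (q : UnitTime) (k : ℕ) (ρ : FinPerm)
    (hρ : μ {ω | block S q k (endTime q) ω = ρ} ≠ 0)
    (A : Fin ρ.size → Set (Set.Iic q → ℕ)) (hA : ∀ i, MeasurableSet (A i)) :
    μ ({ω | block S q k (endTime q) ω = ρ} ∩
        {ω | ∀ i : Fin ρ.size, (fun t => (block S q k t ω).rightInv i + 1) ∈ A i}) =
      ∏ i : Fin ρ.size, μ.map (fun ω => invPaths S ω 0)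
        ({e | e q = ρ.rightInv i} ∩ {e | (fun t : Set.Iic q => e t + 1) ∈ A i}) := by
  have := hS.isProbabilityMeasure_map
  set ξ := μ.map fun ω => invPaths S ω 0
  set V : Fin ρ.size → Set (UnitTime → ℕ) := fun i =>
    {e | e q = ρ.rightInv i} ∩ {e | (fun t : Set.Iic q => e t + 1) ∈ A i}
  have hV : ∀ i, MeasurableSet (V i) := fun i =>
    (measurable_valueAt q (measurableSet_singleton _)).inter
      ((show Measurable fun (e : UnitTime → ℕ) (t : Set.Iic q) => e t + 1 by fun_prop) (hA i))
  have h1 : μ ({ω | block S q k (endTime q) ω = ρ} ∩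
        {ω | ∀ i : Fin ρ.size, (fun t => (block S q k t ω).rightInv i + 1) ∈ A i}) =
      μ ((fun ω => (blockShift (valueAt q))^[k] (invPaths S ω)) ⁻¹'
        ((fun x (i : Fin ρ.size) => x i) ⁻¹' Set.univ.pi V)) := by
    refine measure_congr ?_
    filter_upwards [hS.ae_good q, hS.ae_block_eq_iff q k ρ hρ] with ω ⟨hmono, hpos⟩ hiff
    have hpath : block S q k (endTime q) ω = ρ → ∀ i : Fin ρ.size,
        (fun t => (block S q k t ω).rightInv i + 1) = fun t : Set.Iic q =>
          (blockShift (valueAt q))^[k] (invPaths S ω) i t + 1 := by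
      intro h i
      funext t
      have hs := block_spec hmono hpos k t
      have he := block_spec hmono hpos k (endTime q)
      rw [hs.2.2 i (by rw [hs.1, ← he.1, h]; exact i.2)]
    refine propext ⟨fun h i _ => ?_, fun h => ?_⟩
    · refine ⟨hiff.1 h.1 i, ?_⟩
      have h2 := h.2 i
      rw [hpath h.1 i] at h2
      exact h2
    · have h1 : block S q k (endTime q) ω = ρ := hiff.2 fun i => (h i trivial).1
      refine ⟨h1, fun i => ?_⟩
      rw [hpath h1 i]
      exact (h i trivial).2
  have hm : Measurable fun (x : ℕ → UnitTime → ℕ) (i : Fin ρ.size) => x i := by fun_prop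
  have hVm : MeasurableSet (Set.univ.pi V) := MeasurableSet.univ_pi hV
  rw [h1, ← Measure.map_apply (hS.measurable_shift q k) (hm hVm), hS.map_shift,
    ← Measure.map_apply hm hVm, Measure.map_infinitePi_infinitePi_of_inj (P := fun _ => ξ)
      Fin.val_injective, Measure.infinitePi_eq_pi, Measure.pi_pi]

lemma IsContinuousMallows.map_cond_block (q : UnitTime) (k : ℕ) (ρ : FinPerm)
    (hρ : μ {ω | block S q k (endTime q) ω = ρ} ≠ 0) :
    (∀ i : Fin ρ.size, μ.map (fun ω => invPaths S ω 0) {e | e q = ρ.rightInv i} ≠ 0) ∧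
    (cond μ {ω | block S q k (endTime q) ω = ρ}).map
        (fun ω (i : Fin ρ.size) t => (block S q k t ω).rightInv i + 1) =
      Measure.pi fun i : Fin ρ.size =>
        (cond (μ.map fun ω => invPaths S ω 0) {e | e q = ρ.rightInv i}).map
          fun e (t : Set.Iic q) => e t + 1 := by
  have := hS.isProbabilityMeasure_map
  have hE : MeasurableSet {ω | block S q k (endTime q) ω = ρ} :=
    hS.measurable_block_apply q k (endTime q) (show MeasurableSet {ρ} from trivial)
  have hH : ∀ n, MeasurableSet {e : UnitTime → ℕ | e q = n} := fun n =>
    measurable_valueAt q (measurableSet_singleton n)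
  have hw : Measurable fun (e : UnitTime → ℕ) (t : Set.Iic q) => e t + 1 := by fun_prop
  have hZ : Measurable fun ω (i : Fin ρ.size) t => (block S q k t ω).rightInv i + 1 := by
    refine measurable_pi_iff.2 fun i => measurable_pi_iff.2 fun t => ?_
    have : Measurable fun τ : FinPerm => τ.rightInv i + 1 := fun _ _ => trivial
    exact this.comp (hS.measurable_block_apply q k t)
  -- With trivial `A` the product formula gives the normalising constant, whose factors are
  -- therefore all nonzero.
  have hprod := hS.measure_block_eq_inter q k ρ hρ (fun _ => Set.univ) fun _ => MeasurableSet.univ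
  simp only [Set.mem_univ, implies_true, Set.ofPred_true, Set.inter_univ] at hprod
  have hne : ∀ i : Fin ρ.size,
      μ.map (fun ω => invPaths S ω 0) {e | e q = ρ.rightInv i} ≠ 0 := fun i h => hρ (by
    rw [hprod]
    exact Finset.prod_eq_zero (Finset.mem_univ i) h)
  refine ⟨hne, ?_⟩
  have hprob : ∀ i : Fin ρ.size, IsProbabilityMeasure
      (cond (μ.map fun ω => invPaths S ω 0) {e | e q = ρ.rightInv i}) := fun i =>
    cond_isProbabilityMeasure (hne i)
  symm
  refine Measure.pi_eq fun A hA => ?_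
  rw [Measure.map_apply hZ (MeasurableSet.univ_pi hA), ProbabilityTheory.cond_apply hE]
  have hset : (fun ω (i : Fin ρ.size) t => (block S q k t ω).rightInv i + 1) ⁻¹'
      Set.univ.pi A =
      {ω | ∀ i : Fin ρ.size, (fun t => (block S q k t ω).rightInv i + 1) ∈ A i} := by
    ext ω
    exact ⟨fun h i => h i trivial, fun h i _ => h i⟩
  rw [hset, hS.measure_block_eq_inter q k ρ hρ A hA, hprod,
    ENNReal.prod_inv_distrib fun i _ j _ _ => Or.inr (measure_ne_top _ _),
    ← Finset.prod_mul_distrib]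
  refine Finset.prod_congr rfl fun i _ => ?_
  rw [Measure.map_apply hw (hA i), ProbabilityTheory.cond_apply (hH _)]
  rfl

lemma IsContinuousMallows.map_cond_block_apply (q : UnitTime) (k : ℕ) (ρ : FinPerm)
    (hρ : μ {ω | block S q k (endTime q) ω = ρ} ≠ 0) :
    (∀ i : Fin ρ.size, (cond μ {ω | block S q k (endTime q) ω = ρ}).map
        (fun ω t => (block S q k t ω).rightInv i + 1) =
      (cond (μ.map fun ω => invPaths S ω 0) {e | e q = ρ.rightInv i}).map
        fun e (t : Set.Iic q) => e t + 1) ∧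
    iIndepFun (fun (i : Fin ρ.size) ω (t : Set.Iic q) => (block S q k t ω).rightInv i + 1)
      (cond μ {ω | block S q k (endTime q) ω = ρ}) := by
  have := hS.isProbabilityMeasure_map
  obtain ⟨hne, hmap⟩ := hS.map_cond_block q k ρ hρ
  have hprob : ∀ i : Fin ρ.size, IsProbabilityMeasure
      (cond (μ.map fun ω => invPaths S ω 0) {e | e q = ρ.rightInv i}) := fun i =>
    cond_isProbabilityMeasure (hne i)
  have hw : Measurable fun (e : UnitTime → ℕ) (t : Set.Iic q) => e t + 1 := by fun_prop
  have hprob' : ∀ i : Fin ρ.size, IsProbabilityMeasure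
      ((cond (μ.map fun ω => invPaths S ω 0) {e | e q = ρ.rightInv i}).map
        fun e (t : Set.Iic q) => e t + 1) := fun i =>
    Measure.isProbabilityMeasure_map hw.aemeasurable
  have hcond : IsProbabilityMeasure (cond μ {ω | block S q k (endTime q) ω = ρ}) :=
    cond_isProbabilityMeasure hρ
  have hZ : ∀ i : Fin ρ.size, Measurable fun ω (t : Set.Iic q) =>
      (block S q k t ω).rightInv i + 1 := by
    refine fun i => measurable_pi_iff.2 fun t => ?_
    have : Measurable fun τ : FinPerm => τ.rightInv i + 1 := fun _ _ => trivial
    exact this.comp (hS.measurable_block_apply q k t)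
  have h1 : ∀ i : Fin ρ.size, (cond μ {ω | block S q k (endTime q) ω = ρ}).map
        (fun ω t => (block S q k t ω).rightInv i + 1) =
      (cond (μ.map fun ω => invPaths S ω 0) {e | e q = ρ.rightInv i}).map
        fun e (t : Set.Iic q) => e t + 1 := by
    intro i
    have h2 := congrArg (Measure.map fun z => z i) hmap
    rw [Measure.map_map (measurable_pi_apply i) (measurable_pi_iff.2 hZ),
      (measurePreserving_eval _ i).map_eq] at h2
    exact h2
  refine ⟨h1, ?_⟩
  rw [iIndepFun_iff_map_fun_eq_pi_map fun i => (hZ i).aemeasurable, hmap]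
  simp only [h1]

/-- The process itself supplies the geometric birth process: any count path plus one. -/
lemma IsContinuousMallows.isGeometricBirthLaw :
    IsGeometricBirthLaw.{u} ((μ.map fun ω => invPaths S ω 0).map fun e t => e t + 1) := by
  obtain ⟨p, hp⟩ := hS.birth 0
  refine ⟨Ω, _, μ, _, inferInstance, hp.isGeometricBirthProcess (hS.geometricMarginals 0), ?_⟩
  rw [Measure.map_map (by fun_prop) (hS.measurable_invPath 0)]
  rfl

theorem IsContinuousMallows.isBlockProcess_block (q : UnitTime) (k : ℕ) :
    IsBlockProcess μ q (block S q k) where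
  measurable := hS.measurable_block_apply q k
  cadlag := hS.cadlag_block q k
  size_eq := by
    filter_upwards [hS.ae_good q] with ω ⟨hmono, hpos⟩ t
    exact PNat.coe_injective ((block_spec hmono hpos k t).1.trans
      (block_spec hmono hpos k (endTime q)).1.symm)
  block := hS.isMallowsBlock q k
  cond_indep ρ hρ := (hS.map_cond_block_apply q k ρ hρ).2
  cond_law := by
    refine ⟨_, hS.isGeometricBirthLaw, fun ρ hρ i => ?_⟩
    rw [(hS.map_cond_block_apply q k ρ hρ).1 i]
    set ξ := μ.map fun ω => invPaths S ω 0
    have hs : Measurable fun (e : UnitTime → ℕ) t => e t + 1 := by fun_prop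
    have hr : Measurable fun (e : UnitTime → ℕ) (t : Set.Iic q) => e t := by fun_prop
    have hw : Measurable fun (e : UnitTime → ℕ) (t : Set.Iic q) => e t + 1 := by fun_prop
    have hH : ∀ n, MeasurableSet {e : UnitTime → ℕ | e q = n} := fun n =>
      measurable_valueAt q (measurableSet_singleton n)
    have hpre : (fun (e : UnitTime → ℕ) t => e t + 1) ⁻¹' {R | R q = ρ.rightInv i + 1} =
        {e | e q = ρ.rightInv i} := by
      ext e
      exact Nat.add_right_cancel_iff
    ext A hA
    rw [Measure.map_apply hw hA, Measure.map_apply hr hA, ProbabilityTheory.cond_apply (hH _),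
      ProbabilityTheory.cond_apply (hH _), Measure.map_apply hs (hH _),
      Measure.map_apply hs ((hH _).inter (hr hA)), Set.preimage_inter, hpre]
    rfl

end Mallows

end MallowsProcess

theorem mainTheorem10 {Ω : Type*} [MeasurableSpace Ω] (μ : MeasureTheory.Measure Ω)
    [MeasureTheory.IsProbabilityMeasure μ]
    (S : MallowsProcess.UnitTime → Ω → Equiv.Perm ℕ)
    (hS : MallowsProcess.IsContinuousMallows μ S)
    (q : MallowsProcess.UnitTime) :
    ∃ B : ℕ → Set.Iic q → Ω → MallowsProcess.FinPerm,
      (∀ᵐ ω ∂μ, ∀ t : Set.Iic q,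
        MallowsProcess.IsDirectSum (S t ω) (fun k => B k t ω)) ∧
      ProbabilityTheory.iIndepFun (fun (k : ℕ) (ω : Ω) (t : Set.Iic q) => B k t ω) μ ∧
      (∀ k, ProbabilityTheory.IdentDistrib
        (fun (ω : Ω) (t : Set.Iic q) => B k t ω) (fun (ω : Ω) (t : Set.Iic q) => B 0 t ω) μ μ) ∧
      ∀ k, MallowsProcess.IsBlockProcess μ q (B k) := by
  refine ⟨MallowsProcess.block S q, ?_, hS.iIndepFun_block q, hS.identDistrib_block q,
    hS.isBlockProcess_block q⟩
  filter_upwards [hS.ae_good q] with ω ⟨hmono, hpos⟩ t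
  exact MallowsProcess.isDirectSum_block hmono hpos t
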